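/- **Theorem 2.5 (approximate uniqueness of almost holomorphic extensions).** Let $d\in\mathbf N$, $s>1$, $C_0>0$, $N_0\in\mathbf N$. Let $\mathcal G^s(\mathbf R^d)$ be the space of $u\in C^\infty(\mathbf R^d)$ such that for every compact $K\subset\mathbf R^d$ there are $A,C>0$ with $|\partial^\alpha u(x)|\le A\,C^{|\alpha|}(\alpha!)^s$ for all $x\in K$ and $\alpha\in\mathbf N^d$; let $\mathcal G^s_b(\mathbf R^d)$ be the subspace for which one pair $A,C$ works for all $x\in\mathbf R^d$, and $\mathcal G^s_0(\mathbf R^d)=\mathcal G^s(\mathbf R^d)\cap C_0^\infty(\mathbf R^d)$. Let $\Omega\subset\mathbf C^d$ be an open set containing a tube $\{|\mathrm{Im}\,z|\le r\}$, $r>0$. A function $\tilde u\in C^\infty(\Omega)$ (smooth in the real sense) is called an almost holomorphic extension of $u\in C^\infty(\mathbf R^d)$ if $\tilde u|_{\mathbf R^d}=u$ and the components $\partial_{\bar z_k}\tilde u$ $(1\le k\le d)$ of $\bar\partial\tilde u$ vanish to infinite order on $\mathbf R^d$. Let $u\in\mathcal G^s_0(\mathbf R^d)$ or $u\in\mathcal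 G^s_b(\mathbf R^d)$, and let $\tilde u_1,\tilde u_2\in C^\infty(\Omega)$ be two almost holomorphic extensions of $u$. Assume that for $j=1,2$ there are $C,\delta>0$ such that for all $\alpha,\beta\in\mathbf N^d$ with $|\alpha|+|\beta|\le N_0+2$, $$\bigl|\partial_z^\alpha\partial_{\bar z}^\beta\bar\partial\tilde u_j(z)\bigr|\le C\exp\Bigl(-\tfrac1{C_0}|\mathrm{Im}\,z|^{-\frac1{s-1}}\Bigr),\qquad 0<|\mathrm{Im}\,z|\le\delta .$$ (a) For every compact $K\subset\mathbf R^d$ there are $C',\delta'>0$ such that for all $\alpha,\beta\in\mathbf N^d$ with $|\alpha|+|\beta|\le N_0$, $$\bigl|\partial_z^\alpha\partial_{\bar z}^\beta(\tilde u_1-\tilde u_2)(z)\bigr|\le C'\,|\mathrm{Im}\,z|^{-\frac1{2(s-1)}}\exp\Bigl(-\tfrac1{C_0}|\mathrm{Im}\,z|^{-\frac1{s-1}}\Bigr)\tag{$*$}$$ whenever $\mathrm{Re}\,z\in K$ and $0<|\mathrm{Im}\,z|\le\delta'$. (b) If in addition $\tilde u_1-\tilde u_2$ is bounded on some tube $\{|\mathrm{Im}\,z|\le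 r'\}$, $r'>0$ (for instance if $\tilde u_1,\tilde u_2$ are bounded there), then $(*)$ holds uniformly near $\mathbf R^d$: there are $C',\delta'>0$ such that $(*)$ holds for all $|\alpha|+|\beta|\le N_0$ and all $z\in\mathbf C^d$ with $0<|\mathrm{Im}\,z|\le\delta'$. -/

import Mathlib

open scoped ContDiff

noncomputable section

namespace Gevrey

/-- The real space `ℝ^d` with its Euclidean norm. -/
abbrev RSpace (d : ℕ) : Type := EuclideanSpace ℝ (Fin d)

/-- The complex space `ℂ^d` with its Hermitian norm, identified with `ℝ^{2d}` as a real space. -/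
abbrev CSpace (d : ℕ) : Type := EuclideanSpace ℂ (Fin d)

/-- The inclusion `ℝ^d ⊂ ℂ^d`. -/
def ofRealVec {d : ℕ} (x : RSpace d) : CSpace d := WithLp.toLp 2 fun j => (x j : ℂ)

/-- `Re z ∈ ℝ^d`. -/
def reVec {d : ℕ} (z : CSpace d) : RSpace d := WithLp.toLp 2 fun j => (z j).re

/-- `Im z ∈ ℝ^d`. -/
def imVec {d : ℕ} (z : CSpace d) : RSpace d := WithLp.toLp 2 fun j => (z j).im

/-- The length `|α|` of a multi-index. -/
def len {d : ℕ} (α : Fin d → ℕ) : ℕ := ∑ j, α j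

/-- `D^α = D_1^{α_1} ⋯ D_d^{α_d}` for a family of (differential) operators `D_j`. -/
def multiPow {d : ℕ} {X : Type*} (D : Fin d → X → X) (α : Fin d → ℕ) (f : X) : X :=
  (List.finRange d).foldr (fun j g => (D j)^[α j] g) f

/-- `∂_{x_j}` on functions on `ℝ^d`. -/
def partialReal {d : ℕ} (j : Fin d) (u : RSpace d → ℂ) : RSpace d → ℂ :=
  fun x => fderiv ℝ u x (EuclideanSpace.single j 1)

/-- `∂_{x_j}` on functions on `ℂ^d`, where `z = x + i y`. -/
def partialX {d : ℕ} (j : Fin d) (f : CSpace d → ℂ) : CSpace d → ℂ :=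
  fun z => fderiv ℝ f z (EuclideanSpace.single j 1)

/-- `∂_{y_j}` on functions on `ℂ^d`, where `z = x + i y`. -/
def partialY {d : ℕ} (j : Fin d) (f : CSpace d → ℂ) : CSpace d → ℂ :=
  fun z => fderiv ℝ f z (EuclideanSpace.single j Complex.I)

/-- `∂_{z_j} = (∂_{x_j} - i ∂_{y_j}) / 2`. -/
def partialZ {d : ℕ} (j : Fin d) (f : CSpace d → ℂ) : CSpace d → ℂ :=
  fun z => (1 / 2 : ℂ) * (partialX j f z - Complex.I * partialY j f z)

/-- `∂_{z̄_j} = (∂_{x_j} + i ∂_{y_j}) / 2`; these are the components of `∂̄ f`. -/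
def partialZbar {d : ℕ} (j : Fin d) (f : CSpace d → ℂ) : CSpace d → ℂ :=
  fun z => (1 / 2 : ℂ) * (partialX j f z + Complex.I * partialY j f z)

/-- `u ∈ 𝒢^s(ℝ^d)`: Gevrey estimates of order `s`, with constants depending on the compact set. -/
def IsGevrey {d : ℕ} (s : ℝ) (u : RSpace d → ℂ) : Prop :=
  ContDiff ℝ ∞ u ∧ ∀ K : Set (RSpace d), IsCompact K → ∃ A > (0 : ℝ), ∃ C > (0 : ℝ),
    ∀ x ∈ K, ∀ α : Fin d → ℕ,
      ‖multiPow partialReal α u x‖ ≤ A * C ^ len α * ((∏ j, (α j).factorial : ℕ) : ℝ) ^ s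

/-- `u ∈ 𝒢^s_0(ℝ^d) = 𝒢^s(ℝ^d) ∩ C^∞_0(ℝ^d)`. -/
def IsGevreyCompact {d : ℕ} (s : ℝ) (u : RSpace d → ℂ) : Prop :=
  IsGevrey s u ∧ HasCompactSupport u

/-- `u ∈ 𝒢^s_b(ℝ^d)`: Gevrey estimates of order `s`, uniformly on `ℝ^d`. -/
def IsGevreyBounded {d : ℕ} (s : ℝ) (u : RSpace d → ℂ) : Prop :=
  ContDiff ℝ ∞ u ∧ ∃ A > (0 : ℝ), ∃ C > (0 : ℝ), ∀ (x : RSpace d) (α : Fin d → ℕ),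
      ‖multiPow partialReal α u x‖ ≤ A * C ^ len α * ((∏ j, (α j).factorial : ℕ) : ℝ) ^ s

/-- `f ∈ C^∞(Ω)` is an almost holomorphic extension of (the restriction to `Ω ∩ ℝ^d` of) `u`:
`f = u` on `Ω ∩ ℝ^d`, and every component of `∂̄ f` is flat there, i.e. all its derivatives of
all orders (including order zero) vanish at the points of `Ω ∩ ℝ^d`. -/
structure IsAlmostHolomorphicExtension {d : ℕ} (Ω : Set (CSpace d)) (u : RSpace d → ℂ)
    (f : CSpace d → ℂ) : Prop where
  smooth : ContDiffOn ℝ ∞ f Ω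
  restrict : ∀ x : RSpace d, ofRealVec x ∈ Ω → f (ofRealVec x) = u x
  flat : ∀ (k : Fin d) (x : RSpace d), ofRealVec x ∈ Ω →
    ∀ n : ℕ, iteratedFDeriv ℝ n (partialZbar k f) (ofRealVec x) = 0

/-- The derivatives `∂_z^α ∂_{z̄}^β ∂̄ f`, `|α| + |β| ≤ N`, are
`O(1) exp (-|Im z|^{-1/(s-1)} / C₀)` for `0 < |Im z| ≤ 1 / O(1)`. -/
def DbarExpSmall {d : ℕ} (s C₀ : ℝ) (N : ℕ) (f : CSpace d → ℂ) : Prop :=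
  ∃ C > (0 : ℝ), ∃ δ > (0 : ℝ), ∀ α β : Fin d → ℕ, len α + len β ≤ N →
    ∀ (k : Fin d) (z : CSpace d), 0 < ‖imVec z‖ → ‖imVec z‖ ≤ δ →
      ‖multiPow partialZ α (multiPow partialZbar β (partialZbar k f)) z‖ ≤
        C * Real.exp (-(‖imVec z‖ ^ (-(1 / (s - 1))) / C₀))

/-- The derivatives `∂_z^α ∂_{z̄}^β w`, `|α| + |β| ≤ N`, are
`O(1) |Im z|^{-1/(2(s-1))} exp (-|Im z|^{-1/(s-1)} / C₀)`, uniformly for `Re z ∈ K` and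
`0 < |Im z| ≤ 1 / O(1)`. -/
def DerivExpSmallOver {d : ℕ} (K : Set (RSpace d)) (s C₀ : ℝ) (N : ℕ) (w : CSpace d → ℂ) : Prop :=
  ∃ C > (0 : ℝ), ∃ δ > (0 : ℝ), ∀ α β : Fin d → ℕ, len α + len β ≤ N →
    ∀ z : CSpace d, reVec z ∈ K → 0 < ‖imVec z‖ → ‖imVec z‖ ≤ δ →
      ‖multiPow partialZ α (multiPow partialZbar β w) z‖ ≤
        C * ‖imVec z‖ ^ (-(1 / (2 * (s - 1)))) *
          Real.exp (-(‖imVec z‖ ^ (-(1 / (s - 1))) / C₀))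

end Gevrey

end

noncomputable section

namespace Gevrey

open Complex Metric Set MeasureTheory
open scoped Real Interval ComplexConjugate Topology

/-! The difference `w = u₁ - u₂` vanishes on the real space and `∂̄ w` is exponentially small, so
the question is how fast a function with small `∂̄` and zero real trace must decay. It decays at the
same exponential rate, even without the factor `|Im z|^{-1/(2(s-1))}`, which is at least 1 near the
real space.

The core is one-variable (`norm_le_exp_of_dbarPart_le`). Let `ψ` be flat to first order on the real
axis and extend it by zero to the lower half-plane; the extension is still C¹. Multiply it by an
entire weight equal to 1 at `iτ₀` and apply the approximate mean value property on the disc of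
radius `r/2` about `iτ₀`. The weight is `exp(iλ(z - iτ₀) - λ(z - iτ₀)²/4)`, where `λ` is the slope
of `-τ^{-a}/C₀` at `τ₀`. It is exponentially small on the upper part of the circle, and the lower
part contributes zero. Inside the disc, concavity of `-τ^{-a}/C₀` (`neg_rpow_div_le_tangent`) bounds
weight times `∂̄ψ` by its rate at `τ₀`.

In several variables, a point `x + iy` lies on the complex line through `x` in the direction
`y/|y|`, and the one-variable bound applies there (`norm_le_exp_of_partialZbar_le`). Derivatives
containing some `∂̄_k` are bounded by hypothesis. For pure `∂_z^α w`, commuting derivatives shows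
that `∂̄` of it is small, and induction on `|α|` shows that it is flat (`multiPow_flat`). What
remains is a crude bound on `∂_z^α w`. Over a compact set this is continuity; globally it follows
from boundedness of `w` by iterated Cauchy estimates on shrinking tubes (`exists_bound_multiPow`).
-/

/-- The `∂`-component of a real linear map `ℂ → ℂ`. -/
def delPart (L : ℂ →L[ℝ] ℂ) : ℂ := (1 / 2 : ℂ) * (L 1 - I * L I)

/-- The `∂̄`-component of a real linear map `ℂ → ℂ`. -/
def dbarPart (L : ℂ →L[ℝ] ℂ) : ℂ := (1 / 2 : ℂ) * (L 1 + I * L I)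

lemma apply_eq_delPart_add_dbarPart (L : ℂ →L[ℝ] ℂ) (v : ℂ) :
    L v = delPart L * v + dbarPart L * conj v := by
  have h : v = v.re • (1 : ℂ) + v.im • I := by
    simp [Complex.re_add_im]
  have h2 : L v = v.re * L 1 + v.im * L I := by
    conv_lhs => rw [h]
    rw [map_add, map_smul, map_smul]; simp
  rw [h2, delPart, dbarPart]
  have h3 : conj v = v.re - v.im * I := by
    apply Complex.ext <;> simp
  have h4 : v = v.re + v.im * I := (Complex.re_add_im v).symm
  rw [h3]
  conv_rhs => rw [h4]
  simp only [add_re, ofReal_re, mul_re, I_re, mul_zero, ofReal_im, I_im, mul_one, sub_self, add_zero,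
    add_im, mul_im, zero_add]
  linear_combination ((v.im : ℂ) * L I) * I_sq

/-! ### Mean value property and Cauchy estimate on discs, with a `∂̄` error. -/

section Circle

variable {G : ℂ → ℂ} {G' : ℂ → ℂ →L[ℝ] ℂ} {c : ℂ} {R : ℝ}

lemma circleMap_mem_ball_of_abs_lt {ρ : ℝ} (h : |ρ| < R) (θ : ℝ) : circleMap c ρ θ ∈ ball c R := by
  simpa [circleMap, dist_eq_norm] using h

lemma hasDerivAt_circleMap_radius (c : ℂ) (ρ θ : ℝ) :
    HasDerivAt (fun r : ℝ => circleMap c r θ) (exp (θ * I)) ρ := by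
  have h : HasDerivAt (fun r : ℝ => (r : ℂ)) 1 ρ := ofRealCLM.hasDerivAt
  simpa [circleMap] using (h.mul_const (exp (θ * I))).const_add c

lemma continuous_comp_circleMap {X : Type*} [TopologicalSpace X] {F : ℂ → X}
    (hF : ContinuousOn F (ball c R)) {ρ : ℝ} (hρ : |ρ| < R) :
    Continuous fun θ : ℝ => F (circleMap c ρ θ) :=
  hF.comp_continuous (continuous_circleMap c ρ) (circleMap_mem_ball_of_abs_lt hρ)

lemma hasDerivAt_circle_integral (hG : ∀ z ∈ ball c R, HasFDerivAt G (G' z) z)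
    (hG' : ContinuousOn G' (ball c R)) {ρ : ℝ} (hρ : |ρ| < R) :
    HasDerivAt (fun r : ℝ => ∫ θ in (0 : ℝ)..2 * π, G (circleMap c r θ))
      (∫ θ in (0 : ℝ)..2 * π, G' (circleMap c ρ θ) (exp (θ * I))) ρ := by
  obtain ⟨R₁, h1, h2⟩ := exists_between hρ
  have hcont : ContinuousOn G (ball c R) := fun z hz => (hG z hz).continuousAt.continuousWithinAt
  obtain ⟨B, hB⟩ := (isCompact_closedBall c R₁).exists_bound_of_continuousOn
    (hG'.mono (closedBall_subset_ball h2))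
  have hs : {r : ℝ | |r| < R₁} ∈ nhds ρ :=
    (isOpen_lt continuous_abs continuous_const).mem_nhds h1
  have hE : Continuous fun θ : ℝ => exp (θ * I) := by fun_prop
  refine (intervalIntegral.hasDerivAt_integral_of_dominated_loc_of_deriv_le
    (F' := fun r θ => G' (circleMap c r θ) (exp (θ * I))) (bound := fun _ => B)
    hs ?_ ?_ ?_ ?_ ?_ ?_).2
  · filter_upwards [hs] with r hr
    exact (continuous_comp_circleMap hcont (lt_trans hr h2)).aestronglyMeasurable
  · exact (continuous_comp_circleMap hcont hρ).intervalIntegrable _ _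
  · exact ((continuous_comp_circleMap hG' hρ).clm_apply hE).aestronglyMeasurable
  · refine Filter.Eventually.of_forall fun θ _ r hr => ?_
    have := (G' (circleMap c r θ)).le_opNorm (exp (θ * I))
    rw [norm_exp_ofReal_mul_I, mul_one] at this
    exact this.trans (hB _ (by simpa [circleMap, dist_eq_norm] using le_of_lt hr))
  · exact intervalIntegrable_const
  · refine Filter.Eventually.of_forall fun θ _ r hr => ?_
    exact (hG _ (circleMap_mem_ball_of_abs_lt (lt_trans hr h2) θ)).comp_hasDerivAt r
      (hasDerivAt_circleMap_radius c r θ)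

lemma integral_tangential_eq_zero (hG : ∀ z ∈ ball c R, HasFDerivAt G (G' z) z)
    (hG' : ContinuousOn G' (ball c R)) {ρ : ℝ} (hρ : |ρ| < R) :
    ∫ θ in (0 : ℝ)..2 * π, G' (circleMap c ρ θ) (exp (θ * I) * I) = 0 := by
  have hE : Continuous fun θ : ℝ => exp (θ * I) * I := by fun_prop
  have hper : exp ((2 * π : ℝ) * I) = 1 := by
    push_cast; exact exp_two_pi_mul_I
  -- The integrand is a θ-derivative of a periodic function: of `G` on the circle, up to the factor
  -- `ρ`, or of `G' c (exp (θ * I))` when `ρ = 0`.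
  rcases eq_or_ne ρ 0 with rfl | h0
  · have hd : ∀ θ : ℝ, HasDerivAt (fun θ : ℝ => G' c (exp (θ * I))) (G' c (exp (θ * I) * I)) θ := by
      intro θ
      have h : HasDerivAt (fun θ : ℝ => exp (θ * I)) (exp (θ * I) * I) θ := by
        have h := hasDerivAt_circleMap 0 1 θ
        have h1 : circleMap 0 1 = fun θ : ℝ => exp (θ * I) := by
          ext θ; simp [circleMap]
        rwa [h1] at h
      exact (G' c).hasFDerivAt.comp_hasDerivAt θ h
    simp only [circleMap_zero_radius, Function.const_apply]
    rw [intervalIntegral.integral_eq_sub_of_hasDerivAt (fun θ _ => hd θ)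
      (((G' c).continuous.comp hE).intervalIntegrable _ _), hper]
    simp
  · have hd : ∀ θ : ℝ, HasDerivAt (fun θ : ℝ => G (circleMap c ρ θ))
        (ρ • G' (circleMap c ρ θ) (exp (θ * I) * I)) θ := by
      intro θ
      have h := (hG _ (circleMap_mem_ball_of_abs_lt hρ θ)).comp_hasDerivAt θ
        (hasDerivAt_circleMap c ρ θ)
      have h1 : ρ • G' (circleMap c ρ θ) (exp (θ * I) * I) =
          G' (circleMap c ρ θ) (circleMap 0 ρ θ * I) := by
        rw [← map_smul]
        congr 1
        simp [circleMap, mul_assoc]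
      rw [h1]
      exact h
    have := intervalIntegral.integral_eq_sub_of_hasDerivAt (a := 0) (b := 2 * π) (fun θ _ => hd θ)
      ((((continuous_comp_circleMap hG' hρ).clm_apply hE).const_smul ρ).intervalIntegrable _ _)
    rw [intervalIntegral.integral_smul] at this
    have hp : circleMap c ρ (2 * π) = circleMap c ρ 0 := by
      simp [circleMap]
    rw [hp, sub_self] at this
    exact (smul_eq_zero.1 this).resolve_left h0

/-- Adding `I` times the tangential derivative, whose integral is zero, cancels the `∂` part of the
radial one. Hence circle means change with the radius only through `∂̄`. -/
lemma integral_radial_eq_dbarPart (hG : ∀ z ∈ ball c R, HasFDerivAt G (G' z) z)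
    (hG' : ContinuousOn G' (ball c R)) {ρ : ℝ} (hρ : |ρ| < R) :
    ∫ θ in (0 : ℝ)..2 * π, G' (circleMap c ρ θ) (exp (θ * I)) =
      ∫ θ in (0 : ℝ)..2 * π, 2 * dbarPart (G' (circleMap c ρ θ)) * conj (exp (θ * I)) := by
  have hE : Continuous fun θ : ℝ => exp (θ * I) := by fun_prop
  have hc := continuous_comp_circleMap hG' hρ
  have h0 := integral_tangential_eq_zero hG hG' hρ
  have : ∀ θ : ℝ, 2 * dbarPart (G' (circleMap c ρ θ)) * conj (exp (θ * I)) =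
      G' (circleMap c ρ θ) (exp (θ * I)) + I * G' (circleMap c ρ θ) (exp (θ * I) * I) := by
    intro θ
    rw [apply_eq_delPart_add_dbarPart, apply_eq_delPart_add_dbarPart _ (_ * I), map_mul, conj_I]
    linear_combination (-(delPart (G' (circleMap c ρ θ)) * exp (θ * I)) +
      dbarPart (G' (circleMap c ρ θ)) * conj (exp (θ * I))) * I_sq
  simp_rw [this]
  rw [intervalIntegral.integral_add, intervalIntegral.integral_const_mul, h0]
  · simp
  · exact (hc.clm_apply hE).intervalIntegrable _ _
  · exact (continuous_const.mul (hc.clm_apply (hE.mul continuous_const))).intervalIntegrable _ _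

lemma integral_radial_eq_delPart (hG : ∀ z ∈ ball c R, HasFDerivAt G (G' z) z)
    (hG' : ContinuousOn G' (ball c R)) {ρ : ℝ} (hρ : |ρ| < R) :
    ∫ θ in (0 : ℝ)..2 * π, G' (circleMap c ρ θ) (exp (θ * I)) =
      ∫ θ in (0 : ℝ)..2 * π, 2 * delPart (G' (circleMap c ρ θ)) * exp (θ * I) := by
  have hE : Continuous fun θ : ℝ => exp (θ * I) := by fun_prop
  have hc := continuous_comp_circleMap hG' hρ
  have h0 := integral_tangential_eq_zero hG hG' hρ
  have : ∀ θ : ℝ, 2 * delPart (G' (circleMap c ρ θ)) * exp (θ * I) =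
      G' (circleMap c ρ θ) (exp (θ * I)) - I * G' (circleMap c ρ θ) (exp (θ * I) * I) := by
    intro θ
    rw [apply_eq_delPart_add_dbarPart, apply_eq_delPart_add_dbarPart _ (_ * I), map_mul, conj_I]
    linear_combination (delPart (G' (circleMap c ρ θ)) * exp (θ * I) -
      dbarPart (G' (circleMap c ρ θ)) * conj (exp (θ * I))) * I_sq
  simp_rw [this]
  rw [intervalIntegral.integral_sub, intervalIntegral.integral_const_mul, h0]
  · simp
  · exact (hc.clm_apply hE).intervalIntegrable _ _
  · exact (continuous_const.mul (hc.clm_apply (hE.mul continuous_const))).intervalIntegrable _ _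

/-- Approximate mean value property of functions with small `∂̄`. -/
lemma norm_circle_integral_sub_le (hG : ∀ z ∈ ball c R, HasFDerivAt G (G' z) z)
    (hG' : ContinuousOn G' (ball c R)) {B : ℝ} (hB : ∀ z ∈ ball c R, ‖dbarPart (G' z)‖ ≤ B)
    {ρ : ℝ} (h0 : 0 ≤ ρ) (hρ : ρ < R) :
    ‖(∫ θ in (0 : ℝ)..2 * π, G (circleMap c ρ θ)) - 2 * π * G c‖ ≤ 4 * π * B * ρ := by
  have key := norm_image_sub_le_of_norm_deriv_le_segment' (a := 0) (b := ρ) (C := 4 * π * B)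
    (f := fun r : ℝ => ∫ θ in (0 : ℝ)..2 * π, G (circleMap c r θ))
    (f' := fun r : ℝ => ∫ θ in (0 : ℝ)..2 * π, G' (circleMap c r θ) (exp (θ * I)))
    (fun r hr => (hasDerivAt_circle_integral hG hG'
      (by rw [abs_of_nonneg hr.1]; exact hr.2.trans_lt hρ)).hasDerivWithinAt) ?_ ρ ⟨h0, le_rfl⟩
  · simpa using key
  · intro r hr
    have hr' : |r| < R := by rw [abs_of_nonneg hr.1]; exact hr.2.trans hρ
    rw [integral_radial_eq_dbarPart hG hG' hr']
    refine (intervalIntegral.norm_integral_le_of_norm_le_const (C := 2 * B) fun θ _ => ?_).trans ?_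
    · rw [norm_mul, norm_mul, RCLike.norm_conj, norm_exp_ofReal_mul_I, mul_one]
      simpa using hB _ (circleMap_mem_ball_of_abs_lt hr' θ)
    · rw [sub_zero, abs_of_pos Real.two_pi_pos]
      linarith

/-- Approximate maximum principle: a bound at the centre of a disc by the values on a circle
and by `∂̄`. -/
lemma norm_center_le (hG : ∀ z ∈ ball c R, HasFDerivAt G (G' z) z)
    (hG' : ContinuousOn G' (ball c R)) {B : ℝ} (hB : ∀ z ∈ ball c R, ‖dbarPart (G' z)‖ ≤ B)
    {ρ M : ℝ} (h0 : 0 ≤ ρ) (hρ : ρ < R) (hM : ∀ z, dist z c = ρ → ‖G z‖ ≤ M) :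
    ‖G c‖ ≤ M + 2 * B * ρ := by
  have h1 := norm_circle_integral_sub_le hG hG' hB h0 hρ
  have h2 : ‖∫ θ in (0 : ℝ)..2 * π, G (circleMap c ρ θ)‖ ≤ M * |2 * π - 0| :=
    intervalIntegral.norm_integral_le_of_norm_le_const fun θ _ =>
      hM _ (by simp [circleMap, dist_eq_norm, abs_of_nonneg h0])
  rw [sub_zero, abs_of_pos Real.two_pi_pos] at h2
  have h3 : ‖(2 * π : ℂ) * G c‖ = 2 * π * ‖G c‖ := by
    rw [norm_mul]; congr 1; simp [abs_of_pos Real.pi_pos]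
  have h4 : ‖(2 * π : ℂ) * G c‖ ≤ M * (2 * π) + 4 * π * B * ρ := by
    have := norm_sub_norm_le ((2 * π : ℂ) * G c) (∫ θ in (0 : ℝ)..2 * π, G (circleMap c ρ θ))
    rw [norm_sub_rev] at this
    linarith
  rw [h3] at h4
  have : 2 * π * ‖G c‖ ≤ 2 * π * (M + 2 * B * ρ) := by linarith
  exact le_of_mul_le_mul_left this Real.two_pi_pos

/-- Cauchy's estimate for the `∂`-derivative of a function with controlled `∂̄`. -/
lemma norm_delPart_center_le (hG : ∀ z ∈ ball c R, HasFDerivAt G (G' z) z)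
    (hG' : ContinuousOn G' (ball c R)) {H' : ℂ → ℂ →L[ℝ] ℂ}
    (hH : ∀ z ∈ ball c R, HasFDerivAt (fun z => delPart (G' z)) (H' z) z)
    (hH' : ContinuousOn H' (ball c R)) {B : ℝ} (hB : ∀ z ∈ ball c R, ‖dbarPart (H' z)‖ ≤ B)
    {ρ M : ℝ} (h0 : 0 < ρ) (hρ : ρ < R) (hM : ∀ z, dist z c = ρ → ‖G z‖ ≤ M) :
    ‖delPart (G' c)‖ ≤ M / ρ + 4 * B * ρ := by
  -- Since `∂` kills `conj (z - c)`, the `∂`-derivative of this product is `conj (z - c)` times that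
  -- of `G`. The radial derivative of its circle integral is then `2r` times the integral of `∂G`,
  -- and the mean value property of `∂G` compares that with `∂G(c)`.
  set K : ℂ → ℂ := fun z => G z * conj (z - c) with hK
  set K' : ℂ → ℂ →L[ℝ] ℂ := fun z => G z • (conjCLE : ℂ →L[ℝ] ℂ) + conj (z - c) • G' z with hK'def
  have hconj : ∀ z, HasFDerivAt (fun z : ℂ => conj (z - c)) (conjCLE : ℂ →L[ℝ] ℂ) z := by
    intro z
    have h := (conjCLE : ℂ →L[ℝ] ℂ).hasFDerivAt (x := z - c)
    have h2 := h.comp z ((hasFDerivAt_id z).sub_const c)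
    exact h2
  have hKd : ∀ z ∈ ball c R, HasFDerivAt K (K' z) z := fun z hz => (hG z hz).mul (hconj z)
  have hGc : ContinuousOn G (ball c R) := fun z hz => (hG z hz).continuousAt.continuousWithinAt
  have hK' : ContinuousOn K' (ball c R) := by
    have h : Continuous fun z : ℂ => conj (z - c) :=
      continuous_conj.comp (continuous_id.sub continuous_const)
    exact (hGc.smul continuousOn_const).add (h.continuousOn.smul hG')
  have hdel : ∀ z, delPart (K' z) = conj (z - c) * delPart (G' z) := by
    intro z
    simp only [hK'def, delPart, add_apply, smul_apply,
      smul_eq_mul, ContinuousLinearEquiv.coe_coe, conjCLE_apply, map_one, conj_I]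
    linear_combination (1 / 2 : ℂ) * G z * I_sq
  set S : ℝ → ℂ := fun r => (∫ θ in (0 : ℝ)..2 * π, K (circleMap c r θ)) -
    2 * π * r ^ 2 * delPart (G' c) with hS
  have hB0 : 0 ≤ B := (norm_nonneg _).trans (hB c (mem_ball_self (h0.trans hρ)))
  have hsq : ∀ r : ℝ, HasDerivAt (fun r : ℝ => 2 * π * (r : ℂ) ^ 2 * delPart (G' c))
      (2 * π * (2 * r) * delPart (G' c)) r := by
    intro r
    have h : HasDerivAt (fun r : ℝ => (r : ℂ)) 1 r := ofRealCLM.hasDerivAt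
    have := ((h.pow 2).const_mul (2 * π : ℂ)).mul_const (delPart (G' c))
    simpa using this
  have key := norm_image_sub_le_of_norm_deriv_le_segment' (a := 0) (b := ρ)
    (C := 8 * π * B * ρ ^ 2) (f := S)
    (f' := fun r : ℝ => (∫ θ in (0 : ℝ)..2 * π, K' (circleMap c r θ) (exp (θ * I))) -
      2 * π * (2 * r) * delPart (G' c))
    (fun r hr => ((hasDerivAt_circle_integral hKd hK'
      (by rw [abs_of_nonneg hr.1]; exact hr.2.trans_lt hρ)).sub (hsq r)).hasDerivWithinAt)
      ?_ ρ ⟨h0.le, le_rfl⟩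
  · have hS0 : S 0 = 0 := by simp [hS, hK]
    rw [hS0, sub_zero, sub_zero] at key
    have h2 : ‖∫ θ in (0 : ℝ)..2 * π, K (circleMap c ρ θ)‖ ≤ M * ρ * |2 * π - 0| := by
      refine intervalIntegral.norm_integral_le_of_norm_le_const fun θ _ => ?_
      have hd : dist (circleMap c ρ θ) c = ρ := by
        simp [circleMap, dist_eq_norm, abs_of_nonneg h0.le]
      rw [hK]
      simp only [norm_mul, RCLike.norm_conj, ← dist_eq_norm, hd]
      exact mul_le_mul_of_nonneg_right (hM _ hd) h0.le
    rw [sub_zero, abs_of_pos Real.two_pi_pos] at h2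
    have h3 : ‖(2 * π * ρ ^ 2 : ℂ) * delPart (G' c)‖ = 2 * π * ρ ^ 2 * ‖delPart (G' c)‖ := by
      rw [norm_mul]; congr 1; simp [abs_of_pos Real.pi_pos]
    have h4 : ‖(2 * π * ρ ^ 2 : ℂ) * delPart (G' c)‖ ≤ M * ρ * (2 * π) + 8 * π * B * ρ ^ 2 * ρ := by
      have := norm_sub_norm_le ((2 * π * ρ ^ 2 : ℂ) * delPart (G' c))
        (∫ θ in (0 : ℝ)..2 * π, K (circleMap c ρ θ))
      rw [norm_sub_rev] at this
      linarith
    rw [h3] at h4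
    have h5 : 2 * π * ρ ^ 2 * ‖delPart (G' c)‖ ≤ 2 * π * ρ ^ 2 * (M / ρ + 4 * B * ρ) := by
      refine h4.trans (le_of_eq ?_)
      field_simp
      ring
    exact le_of_mul_le_mul_left h5 (by positivity)
  · intro r hr
    have hr' : |r| < R := by rw [abs_of_nonneg hr.1]; exact hr.2.trans hρ
    have h1 : ∫ θ in (0 : ℝ)..2 * π, K' (circleMap c r θ) (exp (θ * I)) =
        2 * r * ∫ θ in (0 : ℝ)..2 * π, delPart (G' (circleMap c r θ)) := by
      rw [integral_radial_eq_delPart hKd hK' hr', ← intervalIntegral.integral_const_mul]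
      congr 1
      ext θ
      rw [hdel]
      have : conj (circleMap c r θ - c) * exp (θ * I) = r := by
        simp only [circleMap, add_sub_cancel_left, map_mul, conj_ofReal]
        rw [mul_assoc, mul_comm (conj _), mul_conj, normSq_eq_norm_sq, norm_exp_ofReal_mul_I]
        simp
      linear_combination 2 * delPart (G' (circleMap c r θ)) * this
    have h2 := norm_circle_integral_sub_le hH hH' hB hr.1 (hr.2.trans hρ)
    rw [h1, show ∀ X : ℂ, 2 * (r : ℂ) * X - 2 * π * (2 * r) * delPart (G' c) =
      2 * r * (X - 2 * π * delPart (G' c)) by intro X; ring, norm_mul]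
    have h3 : ‖(2 * r : ℂ)‖ = 2 * r := by simp [abs_of_nonneg hr.1]
    rw [h3]
    have hr0 : 0 ≤ r := hr.1
    calc 2 * r * _ ≤ 2 * r * (4 * π * B * r) := by gcongr
      _ = 8 * π * B * r ^ 2 := by ring
      _ ≤ 8 * π * B * ρ ^ 2 := by
        have := hr.2.le
        have := Real.pi_pos
        gcongr

end Circle

/-! ### Exponential decay in one complex variable. -/

/-- The chain is `x^{-a} ≥ 1 - a log x` and `log x ≤ 2(√x - 1)`. The gain is `x - 1 - 2(√x - 1) =
(√x - 1)²`, compared with `(x - 1)²` through `(√x + 1)² ≤ 2(x + 1)`. -/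
lemma rpow_neg_ge_tangent {a x q : ℝ} (ha : 0 < a) (hx : 0 < x) (hq0 : 0 ≤ q)
    (hq : q * (x + 1) ≤ 1 / 2) : 1 - a * (x - 1) + a * q * (x - 1) ^ 2 ≤ x ^ (-a) := by
  have h1 : 1 - a * Real.log x ≤ x ^ (-a) := by
    rw [Real.rpow_def_of_pos hx]
    have := Real.add_one_le_exp (Real.log x * -a)
    linarith
  have hs : 0 < √x := Real.sqrt_pos.2 hx
  have hsx : √x * √x = x := Real.mul_self_sqrt hx.le
  have h2 : Real.log x ≤ 2 * (√x - 1) := by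
    have := Real.log_le_sub_one_of_pos hs
    rw [Real.log_sqrt hx.le] at this
    linarith
  have h3 : q * (x - 1) ^ 2 ≤ x - 1 - 2 * (√x - 1) := by
    have e1 : (x - 1) ^ 2 = (√x - 1) ^ 2 * (√x + 1) ^ 2 := by
      have : (√x * √x - 1) ^ 2 = (√x - 1) ^ 2 * (√x + 1) ^ 2 := by ring
      rwa [hsx] at this
    have e2 : x - 1 - 2 * (√x - 1) = (√x - 1) ^ 2 := by nlinarith
    have e3 : q * (√x + 1) ^ 2 ≤ 1 := by
      have e4 := mul_nonneg hq0 (sq_nonneg (√x - 1))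
      nlinarith
    rw [e1, e2]
    nlinarith [mul_le_mul_of_nonneg_left e3 (sq_nonneg (√x - 1))]
  have h4 := mul_le_mul_of_nonneg_left h3 ha.le
  have h5 := mul_le_mul_of_nonneg_left h2 ha.le
  linarith

/-- The function `-τ^{-a} / C₀` lies below its tangent at `τ₀`, with a quadratic gain. -/
lemma neg_rpow_div_le_tangent {a C₀ τ τ₀ : ℝ} (ha : 0 < a) (hC₀ : 0 < C₀) (hτ : 0 < τ)
    (hτ₀ : 0 < τ₀) (hsum : τ + τ₀ ≤ 2) :
    -(τ ^ (-a) / C₀) - a * τ₀ ^ (-a) / (τ₀ * C₀) * (τ - τ₀)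
      + a * τ₀ ^ (-a) / (τ₀ * C₀) / 4 * (τ - τ₀) ^ 2 ≤ -(τ₀ ^ (-a) / C₀) := by
  have hP : 0 < τ₀ ^ (-a) := Real.rpow_pos_of_pos hτ₀ _
  have hx : 0 < τ / τ₀ := div_pos hτ hτ₀
  -- With `x = τ / τ₀`, this `q` makes the side condition `(τ + τ₀) / 4 ≤ 1 / 2`.
  have h := rpow_neg_ge_tangent (q := τ₀ / 4) ha hx (by positivity)
    (by field_simp; linarith)
  have h1 : τ ^ (-a) = τ₀ ^ (-a) * (τ / τ₀) ^ (-a) := by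
    rw [← Real.mul_rpow hτ₀.le hx.le]; congr 1; field_simp
  have h2 := mul_le_mul_of_nonneg_left h (div_pos hP hC₀).le
  have h3 : τ₀ ^ (-a) / C₀ * (1 - a * (τ / τ₀ - 1) + a * (τ₀ / 4) * (τ / τ₀ - 1) ^ 2) =
      τ₀ ^ (-a) / C₀ - a * τ₀ ^ (-a) / (τ₀ * C₀) * (τ - τ₀)
        + a * τ₀ ^ (-a) / (τ₀ * C₀) / 4 * (τ - τ₀) ^ 2 := by
    field_simp
  have h4 : τ ^ (-a) / C₀ = τ₀ ^ (-a) / C₀ * (τ / τ₀) ^ (-a) := by rw [h1]; ring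
  rw [h3, ← h4] at h2
  linarith

/-- At a real point `ψ` is `o(w - z)`, and the extension is dominated by `ψ` in norm. -/
lemma hasFDerivAt_zero_extension {r : ℝ} {ψ : ℂ → ℂ} {ψ' : ℂ → ℂ →L[ℝ] ℂ}
    (hψ : ∀ z : ℂ, |z.im| < r → HasFDerivAt ψ (ψ' z) z)
    (h0 : ∀ z : ℂ, z.im = 0 → ψ z = 0) (h0' : ∀ z : ℂ, z.im = 0 → ψ' z = 0)
    {z : ℂ} (hz : z.im < r) (hr : 0 < r) :
    HasFDerivAt (fun z => if 0 < z.im then ψ z else 0) (if 0 < z.im then ψ' z else 0) z := by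
  rcases lt_trichotomy z.im 0 with h | h | h
  · rw [if_neg h.not_gt]
    refine (hasFDerivAt_const (0 : ℂ) z).congr_of_eventuallyEq ?_
    filter_upwards [continuous_im.continuousAt.eventually_lt continuousAt_const h] with w hw
    rw [if_neg hw.not_gt]
  · rw [if_neg h.not_gt]
    have h1 := hψ z (by rw [h]; simpa using hr)
    rw [h0' z h] at h1
    rw [hasFDerivAt_iff_isLittleO] at h1 ⊢
    refine Asymptotics.IsBigO.trans_isLittleO (Asymptotics.isBigO_of_le _ fun w => ?_) h1
    simp only [h, lt_irrefl, if_false, h0 z h]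
    split_ifs
    · simp
    · simp
  · rw [if_pos h]
    refine (hψ z (by rwa [abs_of_pos h])).congr_of_eventuallyEq ?_
    filter_upwards [continuousAt_const.eventually_lt continuous_im.continuousAt h] with w hw
    rw [if_pos hw]

lemma continuousAt_zero_extension {r : ℝ} {ψ' : ℂ → ℂ →L[ℝ] ℂ}
    (hψ' : ∀ z : ℂ, |z.im| < r → ContinuousAt ψ' z) (h0' : ∀ z : ℂ, z.im = 0 → ψ' z = 0)
    {z : ℂ} (hz : z.im < r) (hr : 0 < r) :
    ContinuousAt (fun z : ℂ => if 0 < z.im then ψ' z else 0) z := by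
  rcases lt_trichotomy z.im 0 with h | h | h
  · refine (continuousAt_const (y := (0 : ℂ →L[ℝ] ℂ))).congr ?_
    filter_upwards [continuous_im.continuousAt.eventually_lt continuousAt_const h] with w hw
    rw [if_neg hw.not_gt]
  · have h1 := hψ' z (by rw [h]; simpa using hr)
    rw [ContinuousAt] at h1 ⊢
    rw [h0' z h] at h1
    simp only [h, lt_irrefl, if_false]
    refine squeeze_zero_norm (fun w => ?_) (by simpa using h1.norm)
    split_ifs
    · exact le_rfl
    · simp
  · refine (hψ' z (by rwa [abs_of_pos h])).congr ?_
    filter_upwards [continuousAt_const.eventually_lt continuous_im.continuousAt h] with w hw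
    rw [if_pos hw]

lemma norm_exp_weight (lam τ₀ : ℝ) (z : ℂ) :
    ‖exp (I * lam * (z - τ₀ * I) - lam / 4 * (z - τ₀ * I) ^ 2)‖ =
      Real.exp (-lam * (z.im - τ₀) - lam / 4 * (z.re ^ 2 - (z.im - τ₀) ^ 2)) := by
  rw [norm_exp]
  congr 1
  have h : I * lam * (z - τ₀ * I) - lam / 4 * (z - τ₀ * I) ^ 2 =
      ((-lam * (z.im - τ₀) - lam / 4 * (z.re ^ 2 - (z.im - τ₀) ^ 2) : ℝ) : ℂ) +
      ((lam * z.re - lam / 2 * z.re * (z.im - τ₀) : ℝ) : ℂ) * I := by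
    conv_lhs => rw [← re_add_im z]
    push_cast
    linear_combination (lam * (z.im - τ₀) - lam / 4 * (z.im - τ₀) ^ 2 : ℂ) * I_sq
  rw [h, add_re, ofReal_re, re_ofReal_mul, I_re, mul_zero, add_zero]

/-- A function on a strip, flat to first order on the real axis, is exponentially small where its
`∂̄` is, with the same exponential rate. -/
lemma norm_le_exp_of_dbarPart_le {a C₀ r B M τ₀ : ℝ} (ha : 0 < a) (hC₀ : 0 < C₀) (hr : 0 < r)
    (hr1 : r ≤ 1) {ψ : ℂ → ℂ} {ψ' : ℂ → ℂ →L[ℝ] ℂ}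
    (hψ : ∀ z : ℂ, |z.im| < r → HasFDerivAt ψ (ψ' z) z)
    (hψ' : ∀ z : ℂ, |z.im| < r → ContinuousAt ψ' z)
    (h0 : ∀ z : ℂ, z.im = 0 → ψ z = 0) (h0' : ∀ z : ℂ, z.im = 0 → ψ' z = 0)
    (hB : ∀ z : ℂ, 0 < z.im → z.im < r →
      ‖dbarPart (ψ' z)‖ ≤ B * Real.exp (-(z.im ^ (-a) / C₀)))
    (hB0 : 0 ≤ B) (hM0 : 0 ≤ M)
    (hM : ∀ z : ℂ, |z.re| ≤ r / 2 → 0 < z.im → z.im < r → ‖ψ z‖ ≤ M)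
    (hτ₀ : 0 < τ₀) (hτ₁ : τ₀ ≤ r ^ 2 / 64) (hτ₂ : τ₀ ≤ a * r ^ 2 / 32) :
    ‖ψ (τ₀ * I)‖ ≤ (M + r * B) * Real.exp (-(τ₀ ^ (-a) / C₀)) := by
  have hP : 0 < τ₀ ^ (-a) := Real.rpow_pos_of_pos hτ₀ _
  set lam : ℝ := a * τ₀ ^ (-a) / (τ₀ * C₀) with hlam
  have hlam0 : 0 < lam := by positivity
  -- The linear phase alone has modulus near 1 at the sides of the circle, where `Im z` is close to
  -- `τ₀`; the quadratic term supplies decay in `Re z` there.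
  set Ew : ℂ → ℂ := fun z => exp (I * lam * (z - τ₀ * I) - lam / 4 * (z - τ₀ * I) ^ 2) with hEw
  have hEd : Differentiable ℂ Ew := by rw [hEw]; fun_prop
  set φ : ℂ → ℂ := fun z => if 0 < z.im then ψ z else 0 with hφ
  set φ' : ℂ → ℂ →L[ℝ] ℂ := fun z => if 0 < z.im then ψ' z else 0 with hφ'
  -- This places the circle of radius `r / 2` inside the disc of radius `r - τ₀`, which stays below
  -- `Im z = r`.
  have hτr : τ₀ < r / 2 := by nlinarith
  have him : ∀ z ∈ ball ((τ₀ : ℂ) * I) (r - τ₀), z.im < r := by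
    intro z hz
    have h1 := (abs_im_le_norm (z - τ₀ * I)).trans_lt (mem_ball_iff_norm.1 hz)
    have h2 : (z - τ₀ * I).im = z.im - τ₀ := by simp
    rw [h2] at h1
    linarith [(abs_lt.1 h1).2]
  set E' : ℂ → ℂ →L[ℝ] ℂ := fun z => (fderiv ℂ Ew z).restrictScalars ℝ with hE'
  have hEd' : ∀ z, HasFDerivAt Ew (E' z) z := fun z =>
    (hEd z).hasFDerivAt.restrictScalars ℝ
  have hEc' : Continuous E' := by
    have : ContDiff ℂ 1 Ew := by rw [hEw]; fun_prop
    exact (ContinuousLinearMap.restrictScalarsL ℂ ℂ ℂ ℝ ℝ).continuous.comp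
      (this.continuous_fderiv one_ne_zero)
  set G' : ℂ → ℂ →L[ℝ] ℂ := fun z => φ z • E' z + Ew z • φ' z with hG'
  have hφd : ∀ z ∈ ball ((τ₀ : ℂ) * I) (r - τ₀), HasFDerivAt φ (φ' z) z := fun z hz =>
    hasFDerivAt_zero_extension hψ h0 h0' (him z hz) hr
  have hGd : ∀ z ∈ ball ((τ₀ : ℂ) * I) (r - τ₀), HasFDerivAt (fun z => φ z * Ew z) (G' z) z :=
    fun z hz => (hφd z hz).mul (hEd' z)
  have hGc : ContinuousOn G' (ball ((τ₀ : ℂ) * I) (r - τ₀)) := fun z hz =>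
    ((((hφd z hz).continuousAt).smul hEc'.continuousAt).add
      (hEd.continuous.continuousAt.smul
        (continuousAt_zero_extension hψ' h0' (him z hz) hr))).continuousWithinAt
  have hdb : ∀ z, dbarPart (G' z) = Ew z * dbarPart (φ' z) := by
    intro z
    have : E' z I = I * E' z 1 := by
      simp [hE']
    simp only [hG', dbarPart, add_apply, smul_apply, smul_eq_mul, this]
    linear_combination (1 / 2 : ℂ) * φ z * E' z 1 * I_sq
  have key := norm_center_le hGd hGc (B := B * Real.exp (-(τ₀ ^ (-a) / C₀))) ?_
    (ρ := r / 2) (M := M * Real.exp (-(τ₀ ^ (-a) / C₀))) (by positivity) (by linarith) ?_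
  · have e1 : Ew (τ₀ * I) = 1 := by simp [hEw]
    have e2 : φ (τ₀ * I) = ψ (τ₀ * I) := by simp [hφ, hτ₀]
    rw [e1, e2, mul_one] at key
    refine key.trans (le_of_eq (by ring))
  · intro z hz
    rw [hdb, norm_mul]
    by_cases hz0 : 0 < z.im
    · have hzr := him z hz
      have h1 := hB z hz0 hzr
      simp only [hφ', if_pos hz0]
      refine (mul_le_mul_of_nonneg_left h1 (norm_nonneg _)).trans ?_
      rw [hEw]
      simp only
      rw [norm_exp_weight, mul_left_comm, ← Real.exp_add]
      refine mul_le_mul_of_nonneg_left (Real.exp_le_exp.2 ?_) hB0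
      -- The quadratic gain cancels exactly the growth `λ (Im z - τ₀)² / 4` of the weight in the
      -- imaginary direction.
      have h2 := neg_rpow_div_le_tangent ha hC₀ hz0 hτ₀ (by linarith)
      rw [← hlam] at h2
      nlinarith [mul_nonneg hlam0.le (sq_nonneg z.re)]
    · simp only [hφ', if_neg hz0]
      have : dbarPart (0 : ℂ →L[ℝ] ℂ) = 0 := by simp [dbarPart]
      rw [this, norm_zero, mul_zero]
      positivity
  · intro z hz
    by_cases hz0 : 0 < z.im
    · have hz2 : z.re ^ 2 + (z.im - τ₀) ^ 2 = r ^ 2 / 4 := by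
        rw [dist_eq_norm] at hz
        have h := congrArg (· ^ 2) hz
        simp only [← normSq_eq_norm_sq, normSq_apply] at h
        simp at h
        nlinarith
      have hre : |z.re| ≤ r / 2 := abs_le_of_sq_le_sq (by nlinarith) (by positivity)
      have hσ : |z.im - τ₀| ≤ r / 2 := abs_le_of_sq_le_sq (by nlinarith) (by positivity)
      have hσ' := abs_le.1 hσ
      simp only [hφ, if_pos hz0, norm_mul]
      have h1 := hM z hre hz0 (by linarith)
      refine mul_le_mul h1 ?_ (norm_nonneg _) hM0
      rw [hEw]
      simp only
      rw [norm_exp_weight]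
      refine Real.exp_le_exp.2 ?_
      -- With `σ = Im z - τ₀`, the right side is `r²/16 + σ - σ²/2` on the circle. Since `Im z > 0`,
      -- one has `σ > -τ₀ ≥ -r²/64`, so at most half of `r²/16` is lost.
      have h2 : r ^ 2 / 32 ≤ (z.im - τ₀) + 1 / 4 * (z.re ^ 2 - (z.im - τ₀) ^ 2) := by
        rcases le_total 0 (z.im - τ₀) with hs | hs
        · nlinarith
        · nlinarith
      have h3 : τ₀ ^ (-a) / C₀ ≤ lam * (r ^ 2 / 32) := by
        rw [hlam, div_mul_eq_mul_div, div_le_div_iff₀ hC₀ (by positivity)]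
        have := mul_le_mul_of_nonneg_left hτ₂ (mul_pos hP hC₀).le
        nlinarith
      have h4 := mul_le_mul_of_nonneg_left h2 hlam0.le
      linarith
    · simp only [hφ, if_neg hz0, zero_mul, norm_zero]
      positivity

/-! ### Combinatorics of iterated operators. -/

section MultiPow

variable {d : ℕ} {X : Type*}

/-- Smoothness, agreement on an open set, subtraction and commutation are all relations preserved by
one operator, hence by all powers. Three slots allow relations such as `p = f - g`. -/
lemma multiPow_rel₃ {Y Z : Type*} {D : Fin d → X → X} {D' : Fin d → Y → Y} {D'' : Fin d → Z → Z}
    (R : X → Y → Z → Prop) (h : ∀ j f g k, R f g k → R (D j f) (D' j g) (D'' j k))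
    (α : Fin d → ℕ) {f : X} {g : Y} {k : Z} (h0 : R f g k) :
    R (multiPow D α f) (multiPow D' α g) (multiPow D'' α k) := by
  have hit : ∀ (n : ℕ) j f g k, R f g k → R ((D j)^[n] f) ((D' j)^[n] g) ((D'' j)^[n] k) := by
    intro n j
    induction n with
    | zero => exact fun _ _ _ h => h
    | succ n ih =>
      intro f g k hfg
      simp only [Function.iterate_succ_apply]
      exact ih _ _ _ (h j _ _ _ hfg)
  unfold multiPow
  induction List.finRange d with
  | nil => exact h0
  | cons i l ih => exact hit _ _ _ _ _ ih

lemma multiPow_zero (D : Fin d → X → X) (f : X) : multiPow D 0 f = f :=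
  multiPow_rel₃ (D := D) (D' := fun _ => id) (D'' := fun _ => id) (α := 0)
    (fun _ _ (_ : X) => multiPow D 0 f = f) (fun _ _ _ _ h => h) (f := f) (g := f) (k := f) <| by
    unfold multiPow
    induction List.finRange d with
    | nil => rfl
    | cons i l ih => simp

lemma len_update_pred {α : Fin d → ℕ} {j : Fin d} (hj : α j ≠ 0) :
    len (Function.update α j (α j - 1)) + 1 = len α := by
  unfold len
  rw [Finset.sum_update_of_mem (Finset.mem_univ j),
    ← Finset.add_sum_erase _ α (Finset.mem_univ j), Finset.sdiff_singleton_eq_erase]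
  omega

lemma foldr_iterate_update_of_notMem {D : Fin d → X → X} {α : Fin d → ℕ} {l : List (Fin d)}
    {j : Fin d} (hj : j ∉ l) (n : ℕ) (f : X) :
    l.foldr (fun i g => (D i)^[Function.update α j n i] g) f =
      l.foldr (fun i g => (D i)^[α i] g) f := by
  refine List.foldr_ext _ _ _ fun i hi g => ?_
  rw [Function.update_of_ne (by rintro rfl; exact hj hi)]

/-- The operators need not commute, so the outermost factor is the first index of the list with
nonzero exponent. The choice depends on `α` alone, not on `D`. -/
lemma exists_foldr_eq_outer {α : Fin d → ℕ} (l : List (Fin d)) (hl : l.Nodup)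
    (h : ∃ i ∈ l, α i ≠ 0) : ∃ j ∈ l, α j ≠ 0 ∧ ∀ (D : Fin d → X → X) (f : X),
      l.foldr (fun i g => (D i)^[α i] g) f =
        D j (l.foldr (fun i g => (D i)^[Function.update α j (α j - 1) i] g) f) := by
  induction l with
  | nil => simp at h
  | cons i l ih =>
    rw [List.nodup_cons] at hl
    by_cases hi : α i = 0
    · obtain ⟨k, hk, hk0⟩ := h
      obtain ⟨j, hj, hj0, hjD⟩ := ih hl.2 ⟨k, by
        rcases List.mem_cons.1 hk with rfl | hk
        · exact absurd hi hk0
        · exact hk, hk0⟩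
      refine ⟨j, List.mem_cons_of_mem _ hj, hj0, fun D f => ?_⟩
      have hij : i ≠ j := by rintro rfl; exact hl.1 hj
      simp only [List.foldr_cons, Function.update_of_ne hij, hi, Function.iterate_zero, id]
      exact hjD D f
    · refine ⟨i, List.mem_cons_self, hi, fun D f => ?_⟩
      simp only [List.foldr_cons, Function.update_self]
      rw [foldr_iterate_update_of_notMem hl.1, ← Function.iterate_succ_apply' (D i),
        Nat.succ_eq_add_one, Nat.sub_add_cancel (Nat.pos_of_ne_zero hi)]

/-- Here the last index with nonzero exponent is peeled off; this later exposes `∂̄_k w` inside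
`∂̄^β w`. -/
lemma exists_foldr_eq_inner {α : Fin d → ℕ} (l : List (Fin d)) (hl : l.Nodup)
    (h : ∃ i ∈ l, α i ≠ 0) : ∃ j ∈ l, α j ≠ 0 ∧ ∀ (D : Fin d → X → X) (f : X),
      l.foldr (fun i g => (D i)^[α i] g) f =
        l.foldr (fun i g => (D i)^[Function.update α j (α j - 1) i] g) (D j f) := by
  induction l with
  | nil => simp at h
  | cons i l ih =>
    rw [List.nodup_cons] at hl
    by_cases hl0 : ∃ k ∈ l, α k ≠ 0
    · obtain ⟨j, hj, hj0, hjD⟩ := ih hl.2 hl0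
      refine ⟨j, List.mem_cons_of_mem _ hj, hj0, fun D f => ?_⟩
      have hij : i ≠ j := by rintro rfl; exact hl.1 hj
      simp only [List.foldr_cons, Function.update_of_ne hij]
      rw [hjD D f]
    · push Not at hl0
      obtain ⟨k, hk, hk0⟩ := h
      have hki : k = i := by
        rcases List.mem_cons.1 hk with h | h
        · exact h
        · exact absurd (hl0 k h) hk0
      subst hki
      refine ⟨k, List.mem_cons_self, hk0, fun D f => ?_⟩
      have hid : ∀ g : X, l.foldr (fun i g => (D i)^[α i] g) g = g := by
        intro g
        clear ih hk hl
        induction l with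
        | nil => rfl
        | cons i l ih =>
          rw [List.foldr_cons, hl0 i List.mem_cons_self, Function.iterate_zero, id]
          exact ih fun k hk => hl0 k (List.mem_cons_of_mem _ hk)
      simp only [List.foldr_cons, Function.update_self]
      rw [foldr_iterate_update_of_notMem hl.1, hid, hid, ← Function.iterate_succ_apply (D k),
        Nat.succ_eq_add_one, Nat.sub_add_cancel (Nat.pos_of_ne_zero hk0)]

lemma exists_multiPow_eq_outer {α : Fin d → ℕ} (h : α ≠ 0) :
    ∃ (j : Fin d) (α' : Fin d → ℕ), len α' + 1 = len α ∧ ∀ (D : Fin d → X → X) (f : X),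
      multiPow D α f = D j (multiPow D α' f) := by
  obtain ⟨i, hi⟩ := Function.ne_iff.1 h
  obtain ⟨j, -, hj0, hj⟩ := exists_foldr_eq_outer (X := X) (List.finRange d)
    (List.nodup_finRange d) ⟨i, List.mem_finRange i, hi⟩
  exact ⟨j, _, len_update_pred hj0, hj⟩

lemma exists_multiPow_eq_inner {α : Fin d → ℕ} (h : α ≠ 0) :
    ∃ (j : Fin d) (α' : Fin d → ℕ), len α' + 1 = len α ∧ ∀ (D : Fin d → X → X) (f : X),
      multiPow D α f = multiPow D α' (D j f) := by
  obtain ⟨i, hi⟩ := Function.ne_iff.1 h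
  obtain ⟨j, -, hj0, hj⟩ := exists_foldr_eq_inner (X := X) (List.finRange d)
    (List.nodup_finRange d) ⟨i, List.mem_finRange i, hi⟩
  exact ⟨j, _, len_update_pred hj0, hj⟩

end MultiPow

/-! ### Calculus of `∂_z` and `∂_{z̄}` on open sets. -/

section Wirtinger

variable {d : ℕ} {U : Set (CSpace d)} {f g : CSpace d → ℂ}

/-- The operators `(∂_{x_j} + c ∂_{y_j}) / 2`. -/
def wirtinger (c : ℂ) (j : Fin d) (f : CSpace d → ℂ) : CSpace d → ℂ := fun z =>
  (1 / 2 : ℂ) * (fderiv ℝ f z (EuclideanSpace.single j 1) +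
    c * fderiv ℝ f z (EuclideanSpace.single j I))

lemma partialZ_eq_wirtinger : (partialZ : Fin d → _) = wirtinger (-I) := by
  ext j f z; simp only [partialZ, wirtinger, partialX, partialY]; ring

lemma partialZbar_eq_wirtinger : (partialZbar : Fin d → _) = wirtinger I := rfl

lemma wirtinger_eqOn (hU : IsOpen U) (c : ℂ) (j : Fin d) (h : EqOn f g U) :
    EqOn (wirtinger c j f) (wirtinger c j g) U := fun z hz => by
  have : fderiv ℝ f z = fderiv ℝ g z := (h.eventuallyEq_of_mem (hU.mem_nhds hz)).fderiv_eq
  simp only [wirtinger, this]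

lemma contDiffOn_wirtinger (hU : IsOpen U) (c : ℂ) (j : Fin d) (hf : ContDiffOn ℝ ∞ f U) :
    ContDiffOn ℝ ∞ (wirtinger c j f) U := by
  have h := hf.fderiv_of_isOpen hU (m := ∞) (by simp)
  exact contDiffOn_const.mul ((h.clm_apply contDiffOn_const).add
    (contDiffOn_const.mul (h.clm_apply contDiffOn_const)))

lemma differentiableAt_of_contDiffOn (hU : IsOpen U) (hf : ContDiffOn ℝ ∞ f U) {z : CSpace d}
    (hz : z ∈ U) : DifferentiableAt ℝ f z :=
  (hf.contDiffAt (hU.mem_nhds hz)).differentiableAt (by simp)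

lemma wirtinger_sub (hU : IsOpen U) (c : ℂ) (j : Fin d) (hf : ContDiffOn ℝ ∞ f U)
    (hg : ContDiffOn ℝ ∞ g U) :
    EqOn (wirtinger c j fun z => f z - g z) (fun z => wirtinger c j f z - wirtinger c j g z) U := by
  intro z hz
  have : fderiv ℝ (fun z => f z - g z) z = fderiv ℝ f z - fderiv ℝ g z :=
    fderiv_fun_sub (differentiableAt_of_contDiffOn hU hf hz) (differentiableAt_of_contDiffOn hU hg hz)
  simp only [wirtinger, this, sub_apply]
  ring

lemma fderiv_wirtinger_apply (hU : IsOpen U) (c : ℂ) (j : Fin d) (hf : ContDiffOn ℝ ∞ f U)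
    {z : CSpace d} (hz : z ∈ U) (v : CSpace d) : fderiv ℝ (wirtinger c j f) z v =
      (1 / 2 : ℂ) * (fderiv ℝ (fderiv ℝ f) z v (EuclideanSpace.single j 1) +
        c * fderiv ℝ (fderiv ℝ f) z v (EuclideanSpace.single j I)) := by
  have h : DifferentiableAt ℝ (fderiv ℝ f) z :=
    ((hf.fderiv_of_isOpen hU (m := ∞) (by simp)).contDiffAt (hU.mem_nhds hz)).differentiableAt
      (by simp)
  have h1 : ∀ e : CSpace d, HasFDerivAt (fun z => fderiv ℝ f z e)
      ((fderiv ℝ (fderiv ℝ f) z).flip e) z := by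
    intro e
    have := h.hasFDerivAt.clm_apply (hasFDerivAt_const e z)
    simpa using this
  have h2 := ((h1 (EuclideanSpace.single j 1)).add
    ((h1 (EuclideanSpace.single j I)).const_mul c)).const_mul (1 / 2 : ℂ)
  have h3 : fderiv ℝ (wirtinger c j f) z = _ := h2.fderiv
  rw [h3]
  simp [mul_add]

lemma wirtinger_comm (hU : IsOpen U) (c c' : ℂ) (j k : Fin d) (hf : ContDiffOn ℝ ∞ f U) :
    EqOn (wirtinger c j (wirtinger c' k f)) (wirtinger c' k (wirtinger c j f)) U := by
  intro z hz
  have hs : IsSymmSndFDerivAt ℝ f z := (hf.contDiffAt (hU.mem_nhds hz)).isSymmSndFDerivAt <| by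
    rw [minSmoothness_of_isRCLikeNormedField]
    exact WithTop.coe_le_coe.2 le_top
  rw [wirtinger, wirtinger]
  simp only [fderiv_wirtinger_apply hU _ _ hf hz]
  rw [hs (EuclideanSpace.single k 1) (EuclideanSpace.single j 1),
    hs (EuclideanSpace.single k 1) (EuclideanSpace.single j I),
    hs (EuclideanSpace.single k I) (EuclideanSpace.single j 1),
    hs (EuclideanSpace.single k I) (EuclideanSpace.single j I)]
  ring

lemma contDiffOn_multiPow (hU : IsOpen U) (c : ℂ) (α : Fin d → ℕ) (hf : ContDiffOn ℝ ∞ f U) :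
    ContDiffOn ℝ ∞ (multiPow (wirtinger c) α f) U :=
  multiPow_rel₃ (D := wirtinger c) (D' := wirtinger c) (D'' := wirtinger c)
    (fun f _ _ => ContDiffOn ℝ ∞ f U) (fun j _ _ _ h => contDiffOn_wirtinger hU c j h)
    α (g := f) (k := f) hf

lemma multiPow_eqOn (hU : IsOpen U) (c : ℂ) (α : Fin d → ℕ) (h : EqOn f g U) :
    EqOn (multiPow (wirtinger c) α f) (multiPow (wirtinger c) α g) U :=
  multiPow_rel₃ (D := wirtinger c) (D' := wirtinger c) (D'' := wirtinger c)
    (fun f g _ => EqOn f g U) (fun j _ _ _ h => wirtinger_eqOn hU c j h) α (k := f) h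

lemma multiPow_sub (hU : IsOpen U) (c : ℂ) (α : Fin d → ℕ) (hf : ContDiffOn ℝ ∞ f U)
    (hg : ContDiffOn ℝ ∞ g U) : EqOn (multiPow (wirtinger c) α fun z => f z - g z)
      (fun z => multiPow (wirtinger c) α f z - multiPow (wirtinger c) α g z) U :=
  (multiPow_rel₃ (D := wirtinger c) (D' := wirtinger c) (D'' := wirtinger c)
    (fun p f g => EqOn p (fun z => f z - g z) U ∧ ContDiffOn ℝ ∞ f U ∧ ContDiffOn ℝ ∞ g U)
    (fun j _ _ _ h => ⟨(wirtinger_eqOn hU c j h.1).trans (wirtinger_sub hU c j h.2.1 h.2.2),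
      contDiffOn_wirtinger hU c j h.2.1, contDiffOn_wirtinger hU c j h.2.2⟩)
    α ⟨fun _ _ => rfl, hf, hg⟩).1

lemma multiPow_wirtinger_comm (hU : IsOpen U) (c c' : ℂ) (α : Fin d → ℕ) (k : Fin d)
    (hf : ContDiffOn ℝ ∞ f U) : EqOn (multiPow (wirtinger c) α (wirtinger c' k f))
      (wirtinger c' k (multiPow (wirtinger c) α f)) U :=
  (multiPow_rel₃ (D := wirtinger c) (D' := wirtinger c) (D'' := wirtinger c)
    (fun p f _ => EqOn p (wirtinger c' k f) U ∧ ContDiffOn ℝ ∞ f U)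
    (fun j _ _ _ h => ⟨(wirtinger_eqOn hU c j h.1).trans (wirtinger_comm hU c c' j k h.2),
      contDiffOn_wirtinger hU c j h.2⟩)
    α (k := f) ⟨fun _ _ => rfl, hf⟩).1

end Wirtinger

/-! ### Tubes, complex lines, and decay in several variables. -/

section Geometry

variable {d : ℕ}

lemma ofRealVec_add_im (z : CSpace d) : z = ofRealVec (reVec z) + I • ofRealVec (imVec z) := by
  ext j
  simp only [ofRealVec, reVec, imVec, PiLp.add_apply, PiLp.smul_apply, smul_eq_mul]
  rw [mul_comm, re_add_im]

@[simp] lemma imVec_ofRealVec (x : RSpace d) : imVec (ofRealVec x) = 0 := by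
  ext j; simp [imVec, ofRealVec]

lemma continuous_imVec : Continuous (imVec : CSpace d → RSpace d) := by
  unfold imVec; fun_prop

lemma continuous_ofRealVec : Continuous (ofRealVec : RSpace d → CSpace d) := by
  unfold ofRealVec; fun_prop

/-- The open tube `{|Im z| < r}`. -/
def tube (d : ℕ) (r : ℝ) : Set (CSpace d) := {z | ‖imVec z‖ < r}

lemma isOpen_tube (r : ℝ) : IsOpen (tube d r) :=
  isOpen_lt continuous_imVec.norm continuous_const

lemma ofRealVec_eq_sum (η : RSpace d) :
    ofRealVec η = ∑ k, η k • (EuclideanSpace.single k 1 : CSpace d) := by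
  ext j
  simp [ofRealVec, Pi.single_apply]

lemma I_smul_ofRealVec_eq_sum (η : RSpace d) :
    I • ofRealVec η = ∑ k, η k • (EuclideanSpace.single k I : CSpace d) := by
  ext j
  simp [ofRealVec, Pi.single_apply, mul_comm]

lemma clm_eq_zero {L : CSpace d →L[ℝ] ℂ} (h1 : ∀ k, L (EuclideanSpace.single k 1) = 0)
    (h2 : ∀ k, L (EuclideanSpace.single k I) = 0) : L = 0 := by
  ext z
  rw [ofRealVec_add_im z, ofRealVec_eq_sum, I_smul_ofRealVec_eq_sum]
  simp [h1, h2]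

section Line

/-- The complex line through `z₀` in the real direction `η`. -/
def complexLine (z₀ : CSpace d) (η : RSpace d) (ζ : ℂ) : CSpace d := z₀ + ζ • ofRealVec η

/-- The linear part of `complexLine`. -/
def lineDir (η : RSpace d) : ℂ →L[ℝ] CSpace d :=
  (ContinuousLinearMap.toSpanSingleton ℂ (ofRealVec η)).restrictScalars ℝ

@[simp] lemma lineDir_apply (η : RSpace d) (ζ : ℂ) : lineDir η ζ = ζ • ofRealVec η := rfl

lemma imVec_complexLine (z₀ : CSpace d) (η : RSpace d) (ζ : ℂ) :
    imVec (complexLine z₀ η ζ) = imVec z₀ + ζ.im • η := by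
  ext j; simp [imVec, complexLine, ofRealVec]

lemma reVec_complexLine (z₀ : CSpace d) (η : RSpace d) (ζ : ℂ) :
    reVec (complexLine z₀ η ζ) = reVec z₀ + ζ.re • η := by
  ext j; simp [reVec, complexLine, ofRealVec]

lemma continuous_complexLine (z₀ : CSpace d) (η : RSpace d) : Continuous (complexLine z₀ η) := by
  unfold complexLine; fun_prop

lemma hasFDerivAt_complexLine (z₀ : CSpace d) (η : RSpace d) (ζ : ℂ) :
    HasFDerivAt (complexLine z₀ η) (lineDir η) ζ :=
  (lineDir η).hasFDerivAt.const_add z₀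

variable {U : Set (CSpace d)} {v : CSpace d → ℂ} {z₀ : CSpace d} {η : RSpace d} {ζ : ℂ}

lemma hasFDerivAt_comp_complexLine (hU : IsOpen U) (hv : ContDiffOn ℝ ∞ v U)
    (hζ : complexLine z₀ η ζ ∈ U) : HasFDerivAt (fun ζ => v (complexLine z₀ η ζ))
      ((fderiv ℝ v (complexLine z₀ η ζ)).comp (lineDir η)) ζ :=
  (differentiableAt_of_contDiffOn hU hv hζ).hasFDerivAt.comp ζ (hasFDerivAt_complexLine z₀ η ζ)

lemma continuousAt_fderiv_comp_complexLine (hU : IsOpen U) (hv : ContDiffOn ℝ ∞ v U)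
    (hζ : complexLine z₀ η ζ ∈ U) :
    ContinuousAt (fun ζ => (fderiv ℝ v (complexLine z₀ η ζ)).comp (lineDir η)) ζ := by
  have h : ContinuousAt (fderiv ℝ v) (complexLine z₀ η ζ) :=
    (hv.continuousOn_fderiv_of_isOpen hU (by simp)).continuousAt (hU.mem_nhds hζ)
  have h2 : ContinuousAt (fun ζ => fderiv ℝ v (complexLine z₀ η ζ)) ζ :=
    ContinuousAt.comp (f := complexLine z₀ η) h (continuous_complexLine z₀ η).continuousAt
  exact h2.clm_comp continuousAt_const

lemma dbarPart_comp_lineDir (v : CSpace d → ℂ) (z : CSpace d) (η : RSpace d) :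
    dbarPart ((fderiv ℝ v z).comp (lineDir η)) = ∑ k, η k * partialZbar k v z := by
  simp only [dbarPart, ContinuousLinearMap.comp_apply, lineDir_apply, one_smul,
    I_smul_ofRealVec_eq_sum]
  rw [ofRealVec_eq_sum, map_sum, map_sum, Finset.mul_sum, ← Finset.sum_add_distrib, Finset.mul_sum]
  refine Finset.sum_congr rfl fun k _ => ?_
  rw [map_smul, map_smul, real_smul, real_smul, partialZbar, partialX, partialY]
  ring

lemma delPart_comp_lineDir (v : CSpace d → ℂ) (z : CSpace d) (η : RSpace d) :
    delPart ((fderiv ℝ v z).comp (lineDir η)) = ∑ k, η k * partialZ k v z := by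
  simp only [delPart, ContinuousLinearMap.comp_apply, lineDir_apply, one_smul,
    I_smul_ofRealVec_eq_sum]
  rw [ofRealVec_eq_sum, map_sum, map_sum, Finset.mul_sum, ← Finset.sum_sub_distrib, Finset.mul_sum]
  refine Finset.sum_congr rfl fun k _ => ?_
  rw [map_smul, map_smul, real_smul, real_smul, partialZ, partialX, partialY]
  ring

end Line

section Flatness

variable {r a C₀ B : ℝ} {v : CSpace d → ℂ}

/-- The bound tends to zero as `p` is approached along an imaginary direction; the index `k`
provides one. -/
lemma eq_zero_of_norm_le_exp (k : Fin d) (ha : 0 < a) (hC₀ : 0 < C₀) (hr : 0 < r)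
    {p : CSpace d} (hp : imVec p = 0) (hv : ContinuousAt v p)
    (hB : ∀ z, 0 < ‖imVec z‖ → ‖imVec z‖ < r →
      ‖v z‖ ≤ B * Real.exp (-(‖imVec z‖ ^ (-a) / C₀))) : v p = 0 := by
  set η : RSpace d := EuclideanSpace.single k 1 with hη
  have hη1 : ‖η‖ = 1 := by simp [hη]
  have hl0 : complexLine p η ((0 : ℝ) * I) = p := by simp [complexLine]
  have hpath : Filter.Tendsto (fun t : ℝ => v (complexLine p η (t * I))) (𝓝[>] 0) (𝓝 (v p)) := by
    have h1 : Continuous fun t : ℝ => complexLine p η (t * I) :=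
      (continuous_complexLine p η).comp (by fun_prop)
    have h2 : Filter.Tendsto (fun t : ℝ => complexLine p η (t * I)) (𝓝[>] 0) (𝓝 p) := by
      have := h1.tendsto 0
      rw [hl0] at this
      exact this.mono_left nhdsWithin_le_nhds
    exact hv.tendsto.comp h2
  have hexp : Filter.Tendsto (fun t : ℝ => B * Real.exp (-(t ^ (-a) / C₀))) (𝓝[>] 0) (𝓝 0) := by
    have h1 := (tendsto_rpow_neg_nhdsGT_zero (neg_lt_zero.2 ha)).atTop_div_const hC₀
    have h2 := (Real.tendsto_exp_neg_atTop_nhds_zero.comp h1).const_mul B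
    simpa using h2
  refine tendsto_nhds_unique hpath (squeeze_zero_norm' ?_ hexp)
  filter_upwards [Ioo_mem_nhdsGT hr] with t ht
  have h : ‖imVec (complexLine p η (t * I))‖ = t := by
    rw [imVec_complexLine, hp, zero_add, norm_smul, hη1]
    simp [abs_of_pos ht.1]
  have := hB (complexLine p η (t * I)) (by rw [h]; exact ht.1) (by rw [h]; exact ht.2)
  rwa [h] at this

/-- Real directional derivatives vanish because `v` is zero along real lines; then `∂̄ v = 0` forces
the imaginary ones to vanish. -/
lemma fderiv_eq_zero_of_flat (hr : 0 < r) (hv : ContDiffOn ℝ ∞ v (tube d r))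
    (h0 : ∀ z, imVec z = 0 → v z = 0) (hd : ∀ k z, imVec z = 0 → partialZbar k v z = 0)
    {z : CSpace d} (hz : imVec z = 0) : fderiv ℝ v z = 0 := by
  have hzt : z ∈ tube d r := by simpa [tube, hz] using hr
  have h1 : ∀ k, fderiv ℝ v z (EuclideanSpace.single k 1) = 0 := by
    intro k
    set η : RSpace d := EuclideanSpace.single k 1 with hη
    have hl : ofRealVec η = EuclideanSpace.single k 1 := by
      ext j; by_cases h : j = k <;> simp [hη, ofRealVec, h]
    have hz0 : complexLine z η ((0 : ℝ) : ℂ) = z := by simp [complexLine]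
    have h2 := hasFDerivAt_comp_complexLine (z₀ := z) (η := η) (ζ := ((0 : ℝ) : ℂ))
      (isOpen_tube r) hv (by rwa [hz0])
    have h3 := h2.comp_hasDerivAt (0 : ℝ) (ofRealCLM.hasDerivAt (x := (0 : ℝ)))
    have h4 : (fun ζ => v (complexLine z η ζ)) ∘ ofReal = fun _ => 0 := by
      ext t
      exact h0 _ (by simp [imVec_complexLine, hz])
    rw [h4] at h3
    have h5 := h3.unique (hasDerivAt_const (0 : ℝ) (0 : ℂ))
    rw [hz0] at h5
    simpa [hl] using h5
  refine clm_eq_zero h1 fun k => ?_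
  have h2 := hd k z hz
  rw [partialZbar, partialX, partialY, h1 k] at h2
  simpa using h2

end Flatness

section Decay

variable {r a C₀ B M : ℝ} {v : CSpace d → ℂ} {K : Set (RSpace d)}

/-- On the line through `Re z` in the unit direction `Im z / |Im z|`, the point `z` has parameter
`i|Im z|` and the imaginary part has norm `|Im ζ|`, so the rate is unchanged. The factor `d` bounds
the sum of the components of `∂̄ v`. -/
lemma norm_le_exp_of_partialZbar_le (ha : 0 < a) (hC₀ : 0 < C₀) (hr : 0 < r) (hr1 : r ≤ 1)
    (hv : ContDiffOn ℝ ∞ v (tube d r)) (h0 : ∀ z, imVec z = 0 → v z = 0)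
    (h0' : ∀ z, imVec z = 0 → fderiv ℝ v z = 0) (hB0 : 0 ≤ B) (hM0 : 0 ≤ M)
    (hB : ∀ k z, 0 < ‖imVec z‖ → ‖imVec z‖ < r →
      ‖partialZbar k v z‖ ≤ B * Real.exp (-(‖imVec z‖ ^ (-a) / C₀)))
    (hM : ∀ z, (∃ x ∈ K, dist (reVec z) x ≤ r / 2) → ‖imVec z‖ < r → ‖v z‖ ≤ M)
    {z : CSpace d} (hzK : reVec z ∈ K) (hz0 : 0 < ‖imVec z‖) (hz1 : ‖imVec z‖ ≤ r ^ 2 / 64)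
    (hz2 : ‖imVec z‖ ≤ a * r ^ 2 / 32) :
    ‖v z‖ ≤ (M + r * (d * B)) * Real.exp (-(‖imVec z‖ ^ (-a) / C₀)) := by
  set x := reVec z with hx
  set y := imVec z with hy
  set η : RSpace d := ‖y‖⁻¹ • y with hη
  have hη1 : ‖η‖ = 1 := by
    rw [hη, norm_smul, norm_inv, norm_norm, inv_mul_cancel₀ hz0.ne']
  set γ := complexLine (ofRealVec x) η with hγ
  have him : ∀ ζ, imVec (γ ζ) = ζ.im • η := fun ζ => by simp [hγ, imVec_complexLine]
  have himn : ∀ ζ, ‖imVec (γ ζ)‖ = |ζ.im| := fun ζ => by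
    rw [him, norm_smul, hη1, mul_one, Real.norm_eq_abs]
  have hre : ∀ ζ, dist (reVec (γ ζ)) x = |ζ.re| := fun ζ => by
    have : reVec (ofRealVec x) = x := by ext j; simp [reVec, ofRealVec]
    rw [hγ, reVec_complexLine, this, dist_eq_norm, add_sub_cancel_left, norm_smul, hη1, mul_one,
      Real.norm_eq_abs]
  have hmem : ∀ ζ : ℂ, |ζ.im| < r → γ ζ ∈ tube d r := fun ζ h => by
    rw [tube, mem_ofPred_eq, himn]; exact h
  have hγz : γ (‖y‖ * I) = z := by
    rw [hγ, complexLine]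
    conv_rhs => rw [ofRealVec_add_im z]
    congr 1
    ext j
    simp only [ofRealVec, hη, PiLp.smul_apply, smul_eq_mul, ofReal_mul, ofReal_inv]
    have : ((‖y‖ : ℝ) : ℂ) ≠ 0 := by exact_mod_cast hz0.ne'
    field_simp
    rfl
  have hzero : ∀ ζ : ℂ, ζ.im = 0 → imVec (γ ζ) = 0 := fun ζ h => by rw [him, h, zero_smul]
  have key := norm_le_exp_of_dbarPart_le (ψ := fun ζ => v (γ ζ))
    (ψ' := fun ζ => (fderiv ℝ v (γ ζ)).comp (lineDir η)) (B := d * B) (M := M) (τ₀ := ‖y‖)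
    ha hC₀ hr hr1
    (fun ζ h => hasFDerivAt_comp_complexLine (isOpen_tube r) hv (hmem ζ h))
    (fun ζ h => continuousAt_fderiv_comp_complexLine (isOpen_tube r) hv (hmem ζ h))
    (fun ζ h => h0 _ (hzero ζ h))
    (fun ζ h => by simp only [h0' _ (hzero ζ h), ContinuousLinearMap.zero_comp])
    ?_ (by positivity) hM0 ?_ hz0 hz1 hz2
  · simpa only [hγz] using key
  · intro ζ h1 h2
    rw [dbarPart_comp_lineDir]
    refine (norm_sum_le_of_le (f := fun k => (η k : ℂ) * partialZbar k v (γ ζ))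
      (n := fun _ => B * Real.exp (-(ζ.im ^ (-a) / C₀))) _ fun k _ => ?_).trans (le_of_eq ?_)
    · have h3 := hB k (γ ζ) (by rw [himn, abs_of_pos h1]; exact h1)
        (by rw [himn, abs_of_pos h1]; exact h2)
      rw [himn, abs_of_pos h1] at h3
      have h4 : ‖(η k : ℂ)‖ ≤ 1 := by
        rw [norm_real, ← hη1]; exact PiLp.norm_apply_le η k
      rw [norm_mul]
      exact (mul_le_of_le_one_left (norm_nonneg _) h4).trans h3
    · simp [mul_assoc]
  · intro ζ h1 h2 h3
    exact hM _ ⟨x, hzK, by rw [hre]; exact h1⟩ (by rw [himn, abs_of_pos h2]; exact h3)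

/-- Cauchy's estimate in a tube. -/
lemma norm_partialZ_le_of_tube (hr : 0 < r) (hv : ContDiffOn ℝ ∞ v (tube d r)) (j : Fin d)
    (hM : ∀ z ∈ tube d r, ‖v z‖ ≤ M)
    (hB : ∀ z ∈ tube d r, ‖partialZbar j (partialZ j v) z‖ ≤ B) {z : CSpace d}
    (hz : z ∈ tube d (r / 2)) : ‖partialZ j v z‖ ≤ M / (r / 4) + 4 * B * (r / 4) := by
  set η : RSpace d := EuclideanSpace.single j 1 with hη
  have hsum : ∀ F : Fin d → ℂ, ∑ k, (η k : ℂ) * F k = F j := by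
    intro F
    rw [Finset.sum_eq_single j]
    · simp [hη]
    · intro k _ hk; simp [hη, hk]
    · simp
  have hv' : ContDiffOn ℝ ∞ (partialZ j v) (tube d r) := by
    rw [partialZ_eq_wirtinger]
    exact contDiffOn_wirtinger (isOpen_tube r) _ _ hv
  have hz0 : complexLine z η 0 = z := by simp [complexLine]
  have hmem : ∀ ζ ∈ ball (0 : ℂ) (r / 2), complexLine z η ζ ∈ tube d r := by
    intro ζ hζ
    have h1 : |ζ.im| < r / 2 := (abs_im_le_norm ζ).trans_lt (by simpa using hζ)
    have h2 : ‖η‖ = 1 := by simp [hη]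
    rw [tube, mem_ofPred_eq, imVec_complexLine]
    refine (norm_add_le _ _).trans_lt ?_
    rw [norm_smul, h2, mul_one, Real.norm_eq_abs]
    have : ‖imVec z‖ < r / 2 := hz
    linarith
  have hdel : ∀ ζ, delPart ((fderiv ℝ v (complexLine z η ζ)).comp (lineDir η)) =
      partialZ j v (complexLine z η ζ) := fun ζ => by rw [delPart_comp_lineDir, hsum]
  have key := norm_delPart_center_le (c := 0) (R := r / 2) (ρ := r / 4) (M := M) (B := B)
    (G := fun ζ => v (complexLine z η ζ))
    (G' := fun ζ => (fderiv ℝ v (complexLine z η ζ)).comp (lineDir η))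
    (H' := fun ζ => (fderiv ℝ (partialZ j v) (complexLine z η ζ)).comp (lineDir η))
    (fun ζ h => hasFDerivAt_comp_complexLine (isOpen_tube r) hv (hmem ζ h))
    (fun ζ h => (continuousAt_fderiv_comp_complexLine (isOpen_tube r) hv
      (hmem ζ h)).continuousWithinAt)
    (fun ζ h => by
      simp only [hdel]
      exact hasFDerivAt_comp_complexLine (isOpen_tube r) hv' (hmem ζ h))
    (fun ζ h => (continuousAt_fderiv_comp_complexLine (isOpen_tube r) hv'
      (hmem ζ h)).continuousWithinAt)
    (fun ζ h => by
      rw [dbarPart_comp_lineDir, hsum]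
      exact hB _ (hmem ζ h))
    (by linarith) (by linarith)
    (fun ζ h => hM _ (hmem ζ (by rw [mem_ball, h]; linarith)))
  rw [hdel, hz0] at key
  exact key

end Decay

end Geometry

/-! ### Bounds for all derivatives. -/

section Estimates

variable {d : ℕ} {r a C₀ B M : ℝ} {N : ℕ} {w : CSpace d → ℂ}

/-- Exponential bounds, in a tube, for the derivatives of `∂̄ w` of order at most `N`. -/
def DbarBound (r a C₀ B : ℝ) (N : ℕ) (w : CSpace d → ℂ) : Prop :=
  ∀ α β : Fin d → ℕ, len α + len β ≤ N → ∀ (k : Fin d) (z : CSpace d), 0 < ‖imVec z‖ →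
    ‖imVec z‖ < r → ‖multiPow partialZ α (multiPow partialZbar β (partialZbar k w)) z‖ ≤
      B * Real.exp (-(‖imVec z‖ ^ (-a) / C₀))

lemma tube_subset_tube {r' : ℝ} (h : r' ≤ r) : tube d r' ⊆ tube d r :=
  fun _ hz => lt_of_lt_of_le hz h

lemma len_zero : len (0 : Fin d → ℕ) = 0 := by simp [len]

lemma finite_setOf_len_le (d N : ℕ) : {α : Fin d → ℕ | len α ≤ N}.Finite :=
  (Set.finite_Iic (fun _ : Fin d => N)).subset fun α (hα : len α ≤ N) j =>
    (Finset.single_le_sum (fun _ _ => Nat.zero_le _) (Finset.mem_univ j)).trans hα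

namespace DbarBound

lemma mono_radius (h : DbarBound r a C₀ B N w) {r' : ℝ} (hr : r' ≤ r) : DbarBound r' a C₀ B N w :=
  fun α β hαβ k z h0 h1 => h α β hαβ k z h0 (h1.trans_le hr)

lemma sub {s : ℝ} {u₁ u₂ : CSpace d → ℂ} (h₁ : ContDiffOn ℝ ∞ u₁ (tube d r))
    (h₂ : ContDiffOn ℝ ∞ u₂ (tube d r)) {B₁ B₂ : ℝ} (hb₁ : DbarBound r s C₀ B₁ N u₁)
    (hb₂ : DbarBound r s C₀ B₂ N u₂) : DbarBound r s C₀ (B₁ + B₂) N fun z => u₁ z - u₂ z := by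
  intro α β hαβ k z h0 hr
  have hU := isOpen_tube (d := d) r
  have e : EqOn
      (multiPow partialZ α (multiPow partialZbar β (partialZbar k fun z => u₁ z - u₂ z)))
      (fun z => multiPow partialZ α (multiPow partialZbar β (partialZbar k u₁)) z -
        multiPow partialZ α (multiPow partialZbar β (partialZbar k u₂)) z) (tube d r) := by
    rw [partialZ_eq_wirtinger, partialZbar_eq_wirtinger]
    have s₁ := contDiffOn_wirtinger hU I k h₁
    have s₂ := contDiffOn_wirtinger hU I k h₂
    have e₁ := (multiPow_eqOn hU I β (wirtinger_sub hU I k h₁ h₂)).trans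
      (multiPow_sub hU I β s₁ s₂)
    exact (multiPow_eqOn hU (-I) α e₁).trans (multiPow_sub hU (-I) α
      (contDiffOn_multiPow hU I β s₁) (contDiffOn_multiPow hU I β s₂))
  rw [e hr, add_mul]
  exact (norm_sub_le _ _).trans (add_le_add (hb₁ α β hαβ k z h0 hr) (hb₂ α β hαβ k z h0 hr))

lemma norm_partialZbar_multiPow_le (h : DbarBound r a C₀ B N w)
    (hw : ContDiffOn ℝ ∞ w (tube d r)) {α : Fin d → ℕ} (hα : len α ≤ N) (k : Fin d) (z : CSpace d)
    (h0 : 0 < ‖imVec z‖) (h1 : ‖imVec z‖ < r) : ‖partialZbar k (multiPow partialZ α w) z‖ ≤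
      B * Real.exp (-(‖imVec z‖ ^ (-a) / C₀)) := by
  have h2 := h α 0 (by rwa [len_zero, add_zero]) k z h0 h1
  rw [multiPow_zero] at h2
  rw [partialZ_eq_wirtinger, partialZbar_eq_wirtinger] at *
  rwa [multiPow_wirtinger_comm (isOpen_tube r) _ _ α k hw h1] at h2

lemma contDiffOn_multiPow_partialZ (hw : ContDiffOn ℝ ∞ w (tube d r)) (α : Fin d → ℕ) :
    ContDiffOn ℝ ∞ (multiPow partialZ α w) (tube d r) := by
  rw [partialZ_eq_wirtinger]; exact contDiffOn_multiPow (isOpen_tube r) _ α hw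

lemma partialZbar_multiPow_eq_zero (h : DbarBound r a C₀ B N w) (ha : 0 < a) (hC₀ : 0 < C₀)
    (hr : 0 < r) (hw : ContDiffOn ℝ ∞ w (tube d r)) {α : Fin d → ℕ} (hα : len α ≤ N) (k : Fin d)
    {z : CSpace d} (hz : imVec z = 0) : partialZbar k (multiPow partialZ α w) z = 0 := by
  refine eq_zero_of_norm_le_exp k ha hC₀ hr hz ?_ (h.norm_partialZbar_multiPow_le hw hα k)
  have h1 := contDiffOn_wirtinger (isOpen_tube r) I k (contDiffOn_multiPow_partialZ hw α)
  exact h1.continuousOn.continuousAt ((isOpen_tube r).mem_nhds (by simpa [tube, hz] using hr))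

/-- Induction on `|α|`: the vanishing differential at one order gives vanishing values at the next,
and smallness of `∂̄` then gives the vanishing differential again. -/
lemma multiPow_flat (h : DbarBound r a C₀ B N w) (ha : 0 < a) (hC₀ : 0 < C₀)
    (hr : 0 < r) (hw : ContDiffOn ℝ ∞ w (tube d r)) (hw0 : ∀ z, imVec z = 0 → w z = 0)
    {α : Fin d → ℕ} (hα : len α ≤ N) : (∀ z, imVec z = 0 → multiPow partialZ α w z = 0) ∧
      ∀ z, imVec z = 0 → fderiv ℝ (multiPow partialZ α w) z = 0 := by
  induction hn : len α generalizing α with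
  | zero =>
    have h1 : ∀ z, imVec z = 0 → multiPow partialZ α w z = 0 := by
      by_cases h0 : α = 0
      · rw [h0, multiPow_zero]; exact hw0
      · obtain ⟨j, α', hl, -⟩ := exists_multiPow_eq_outer (X := CSpace d → ℂ) h0
        omega
    exact ⟨h1, fun z hz => fderiv_eq_zero_of_flat hr (contDiffOn_multiPow_partialZ hw α) h1
      (fun k _ hz => h.partialZbar_multiPow_eq_zero ha hC₀ hr hw hα k hz) hz⟩
  | succ n ih =>
    have h1 : ∀ z, imVec z = 0 → multiPow partialZ α w z = 0 := by
      have h0 : α ≠ 0 := by rintro rfl; rw [len_zero] at hn; omega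
      obtain ⟨j, α', hl, hD⟩ := exists_multiPow_eq_outer (X := CSpace d → ℂ) h0
      intro z hz
      rw [hD, partialZ, partialX, partialY, (ih (by omega) (by omega)).2 z hz]
      simp
    exact ⟨h1, fun z hz => fderiv_eq_zero_of_flat hr (contDiffOn_multiPow_partialZ hw α) h1
      (fun k _ hz => h.partialZbar_multiPow_eq_zero ha hC₀ hr hw hα k hz) hz⟩

lemma norm_partialZbar_multiPow_le_const (h : DbarBound r a C₀ B N w) (ha : 0 < a) (hC₀ : 0 < C₀)
    (hr : 0 < r) (hB : 0 ≤ B) (hw : ContDiffOn ℝ ∞ w (tube d r)) {α : Fin d → ℕ}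
    (hα : len α ≤ N) (k : Fin d) {z : CSpace d} (hz : z ∈ tube d r) :
    ‖partialZbar k (multiPow partialZ α w) z‖ ≤ B := by
  rcases (norm_nonneg (imVec z)).eq_or_lt with h0 | h0
  · rw [h.partialZbar_multiPow_eq_zero ha hC₀ hr hw hα k (norm_eq_zero.1 h0.symm), norm_zero]
    exact hB
  · refine (h.norm_partialZbar_multiPow_le hw hα k z h0 hz).trans (mul_le_of_le_one_right hB ?_)
    exact Real.exp_le_one_iff.2 (neg_nonpos.2 (by positivity))

/-- Each additional `∂_z` costs one Cauchy estimate, which halves the tube. -/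
lemma exists_bound_multiPow (h : DbarBound r a C₀ B N w) (ha : 0 < a) (hC₀ : 0 < C₀)
    (hr : 0 < r) (hB : 0 ≤ B) (hw : ContDiffOn ℝ ∞ w (tube d r))
    (hM : ∀ z ∈ tube d r, ‖w z‖ ≤ M) {n : ℕ} (hn : n ≤ N) : ∃ M', ∀ α : Fin d → ℕ, len α ≤ n →
      ∀ z ∈ tube d (r / 2 ^ n), ‖multiPow partialZ α w z‖ ≤ M' := by
  induction n with
  | zero =>
    refine ⟨M, fun α hα z hz => ?_⟩
    by_cases h0 : α = 0
    · rw [h0, multiPow_zero]; exact hM z (by simpa using hz)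
    · obtain ⟨j, α', hl, -⟩ := exists_multiPow_eq_outer (X := CSpace d → ℂ) h0
      omega
  | succ n ih =>
    obtain ⟨M', hM'⟩ := ih (by omega)
    have hrn : 0 < r / 2 ^ n := by positivity
    have hle : r / 2 ^ n ≤ r := div_le_self hr.le (one_le_pow₀ (by norm_num))
    have hhalf : r / 2 ^ (n + 1) = r / 2 ^ n / 2 := by rw [pow_succ]; field_simp
    refine ⟨max M (M' / (r / 2 ^ n / 4) + 4 * B * (r / 2 ^ n / 4)), fun α hα z hz => ?_⟩
    by_cases h0 : α = 0
    · rw [h0, multiPow_zero]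
      refine (hM z (tube_subset_tube ?_ hz)).trans (le_max_left _ _)
      rw [hhalf]; linarith
    · obtain ⟨j, α', hl, hD⟩ := exists_multiPow_eq_outer (X := CSpace d → ℂ) h0
      refine le_trans ?_ (le_max_right _ _)
      rw [hD]
      refine norm_partialZ_le_of_tube hrn
        (contDiffOn_multiPow_partialZ (hw.mono (tube_subset_tube hle)) α') j
        (hM' α' (by omega)) (fun ζ hζ => ?_) (by rwa [← hhalf])
      rw [← hD partialZ w]
      exact h.norm_partialZbar_multiPow_le_const ha hC₀ hr hB hw (by omega) j
        (tube_subset_tube hle hζ)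

/-- If `β ≠ 0`, the hypothesis on `∂̄ w` already bounds the derivative; if `β = 0`, the decay
estimate applies to `∂_z^α w`. -/
lemma derivExpSmallOver {s : ℝ} (hs : 1 < s) (hC₀ : 0 < C₀) (hr : 0 < r) (hr1 : r ≤ 1)
    (hB : 0 ≤ B) (h : DbarBound r (1 / (s - 1)) C₀ B N w) (hw : ContDiffOn ℝ ∞ w (tube d r))
    (hw0 : ∀ z, imVec z = 0 → w z = 0) {K : Set (RSpace d)}
    (hM : ∀ α : Fin d → ℕ, len α ≤ N → ∀ z, (∃ x ∈ K, dist (reVec z) x ≤ r / 2) →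
      ‖imVec z‖ < r → ‖multiPow partialZ α w z‖ ≤ M) : DerivExpSmallOver K s C₀ N w := by
  have hs0 : 0 < s - 1 := sub_pos.2 hs
  have ha : 0 < 1 / (s - 1) := by positivity
  have hM' : ∀ α : Fin d → ℕ, len α ≤ N → ∀ z, (∃ x ∈ K, dist (reVec z) x ≤ r / 2) →
      ‖imVec z‖ < r → ‖multiPow partialZ α w z‖ ≤ |M| :=
    fun α hα z h1 h2 => (hM α hα z h1 h2).trans (le_abs_self M)
  refine ⟨|M| + r * (d * B) + B + 1, by positivity,
    min (r ^ 2 / 64) (1 / (s - 1) * r ^ 2 / 32), by positivity, fun α β hαβ z hzK hz0 hzδ => ?_⟩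
  have hz1 := hzδ.trans (min_le_left _ _)
  have hz2 := hzδ.trans (min_le_right _ _)
  have hzr : ‖imVec z‖ < r := by nlinarith
  -- The prefactor of the claim only weakens the bound obtained.
  have hone : 1 ≤ ‖imVec z‖ ^ (-(1 / (2 * (s - 1)))) :=
    Real.one_le_rpow_of_pos_of_le_one_of_nonpos hz0 (hzr.le.trans hr1)
      (neg_nonpos.2 (by positivity))
  have hC : ∀ C : ℝ, C ≤ |M| + r * (d * B) + B + 1 →
      C ≤ (|M| + r * (d * B) + B + 1) * ‖imVec z‖ ^ (-(1 / (2 * (s - 1)))) := fun C hC =>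
    hC.trans (le_mul_of_one_le_right (by positivity) hone)
  by_cases hβ : β = 0
  · subst hβ
    rw [len_zero, add_zero] at hαβ
    rw [multiPow_zero]
    obtain ⟨f0, f1⟩ := h.multiPow_flat ha hC₀ hr hw hw0 hαβ
    refine (norm_le_exp_of_partialZbar_le ha hC₀ hr hr1 (contDiffOn_multiPow_partialZ hw α) f0 f1 hB
      (abs_nonneg M) (h.norm_partialZbar_multiPow_le hw hαβ) (hM' α hαβ) hzK hz0 hz1 hz2).trans
      (mul_le_mul_of_nonneg_right (hC _ (by linarith)) (Real.exp_pos _).le)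
  · obtain ⟨k, β', hl, hD⟩ := exists_multiPow_eq_inner (X := CSpace d → ℂ) hβ
    rw [hD]
    refine (h α β' (by omega) k z hz0 hzr).trans
      (mul_le_mul_of_nonneg_right (hC _ ?_) (Real.exp_pos _).le)
    have : 0 ≤ |M| + r * (d * B) := by positivity
    linarith

end DbarBound

lemma isCompact_re_mem_im_le {K : Set (RSpace d)} (hK : IsCompact K) (ρ : ℝ) :
    IsCompact {z : CSpace d | reVec z ∈ K ∧ ‖imVec z‖ ≤ ρ} := by
  have h : Continuous fun p : RSpace d × RSpace d => ofRealVec p.1 + I • ofRealVec p.2 :=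
    (continuous_ofRealVec.comp continuous_fst).add
      ((continuous_ofRealVec.comp continuous_snd).const_smul I)
  refine (((hK.prod (isCompact_closedBall (0 : RSpace d) ρ)).image h).of_isClosed_subset ?_ ?_)
  · have hre : Continuous (reVec : CSpace d → RSpace d) := by unfold reVec; fun_prop
    exact (hK.isClosed.preimage hre).inter (isClosed_le continuous_imVec.norm continuous_const)
  · intro z hz
    exact ⟨(reVec z, imVec z), ⟨hz.1, by simpa using hz.2⟩, (ofRealVec_add_im z).symm⟩

lemma exists_bound_multiPow_of_isCompact {K : Set (RSpace d)} (hK : IsCompact K)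
    (hw : ContDiffOn ℝ ∞ w (tube d r)) {ρ : ℝ} (hρ : ρ < r) (N : ℕ) :
    ∃ M, ∀ α : Fin d → ℕ, len α ≤ N → ∀ z, reVec z ∈ K → ‖imVec z‖ ≤ ρ →
      ‖multiPow partialZ α w z‖ ≤ M := by
  have h : ∀ α : Fin d → ℕ, ∃ M, ∀ z ∈ {z : CSpace d | reVec z ∈ K ∧ ‖imVec z‖ ≤ ρ},
      ‖multiPow partialZ α w z‖ ≤ M := fun α =>
    (isCompact_re_mem_im_le hK ρ).exists_bound_of_continuousOn
      ((DbarBound.contDiffOn_multiPow_partialZ hw α).continuousOn.mono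
        fun z hz => lt_of_le_of_lt hz.2 hρ)
  choose M hM using h
  obtain ⟨M', hM'⟩ := ((finite_setOf_len_le d N).image M).bddAbove
  exact ⟨M', fun α hα z h1 h2 => (hM α z ⟨h1, h2⟩).trans (hM' (mem_image_of_mem M hα))⟩

end Estimates

end Gevrey

end

theorem theorem2p5 (d : ℕ) (s : ℝ) (hs : 1 < s) (N₀ : ℕ) (C₀ : ℝ) (hC₀ : 0 < C₀)
    (u : Gevrey.RSpace d → ℂ)
    (hu : Gevrey.IsGevreyCompact s u ∨ Gevrey.IsGevreyBounded s u)
    (Ω : Set (Gevrey.CSpace d)) (hΩ : IsOpen Ω)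
    (hΩtube : ∃ r > (0 : ℝ), ∀ z : Gevrey.CSpace d, ‖Gevrey.imVec z‖ ≤ r → z ∈ Ω)
    (u₁ u₂ : Gevrey.CSpace d → ℂ)
    (h₁ : Gevrey.IsAlmostHolomorphicExtension Ω u u₁)
    (h₂ : Gevrey.IsAlmostHolomorphicExtension Ω u u₂)
    (hb₁ : Gevrey.DbarExpSmall s C₀ (N₀ + 2) u₁)
    (hb₂ : Gevrey.DbarExpSmall s C₀ (N₀ + 2) u₂) :
    (∀ K : Set (Gevrey.RSpace d), IsCompact K →
      Gevrey.DerivExpSmallOver K s C₀ N₀ (fun z => u₁ z - u₂ z)) ∧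
    ((∃ M : ℝ, ∃ r > (0 : ℝ), ∀ z : Gevrey.CSpace d, ‖Gevrey.imVec z‖ ≤ r → ‖u₁ z - u₂ z‖ ≤ M) →
      Gevrey.DerivExpSmallOver Set.univ s C₀ N₀ (fun z => u₁ z - u₂ z)) := by
  open Gevrey in
  obtain ⟨r₀, hr₀, hΩr⟩ := hΩtube
  obtain ⟨B₁, hB₁, δ₁, hδ₁, hb₁⟩ := hb₁
  obtain ⟨B₂, hB₂, δ₂, hδ₂, hb₂⟩ := hb₂
  have ha : 0 < 1 / (s - 1) := one_div_pos.2 (sub_pos.2 hs)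
  set r : ℝ := min (min r₀ 1) (min δ₁ δ₂) with hr
  have hr0 : 0 < r := by positivity
  have hrr₀ : r ≤ r₀ := (min_le_left _ _).trans (min_le_left _ _)
  have hr1 : r ≤ 1 := (min_le_left _ _).trans (min_le_right _ _)
  have hrδ₁ : r ≤ δ₁ := (min_le_right _ _).trans (min_le_left _ _)
  have hrδ₂ : r ≤ δ₂ := (min_le_right _ _).trans (min_le_right _ _)
  have hsub : tube d r ⊆ Ω := fun z hz => hΩr z ((le_of_lt hz).trans hrr₀)
  have s₁ : ContDiffOn ℝ ∞ u₁ (tube d r) := h₁.smooth.mono hsub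
  have s₂ : ContDiffOn ℝ ∞ u₂ (tube d r) := h₂.smooth.mono hsub
  have hw : ContDiffOn ℝ ∞ (fun z => u₁ z - u₂ z) (tube d r) := s₁.sub s₂
  have hw0 : ∀ z, imVec z = 0 → u₁ z - u₂ z = 0 := by
    intro z hz
    have hz' : z = ofRealVec (reVec z) := by
      conv_lhs => rw [ofRealVec_add_im z, hz]
      ext j; simp [ofRealVec]
    have hzΩ : ofRealVec (reVec z) ∈ Ω := by
      rw [← hz']; exact hΩr z (by rw [hz, norm_zero]; exact hr₀.le)
    rw [hz', h₁.restrict _ hzΩ, h₂.restrict _ hzΩ, sub_self]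
  have hb : DbarBound r (1 / (s - 1)) C₀ (B₁ + B₂) N₀ fun z => u₁ z - u₂ z :=
    DbarBound.sub s₁ s₂
      (fun α β hαβ k z h0 hz => hb₁ α β (by omega) k z h0 (hz.le.trans hrδ₁))
      (fun α β hαβ k z h0 hz => hb₂ α β (by omega) k z h0 (hz.le.trans hrδ₂))
  have hB : 0 ≤ B₁ + B₂ := by positivity
  constructor
  · intro K hK
    -- The decay estimate is used in the tube of radius `r / 2`, so that its closure lies where `w`
    -- is smooth. Its discs reach half that radius away from `K`.
    obtain ⟨M, hM⟩ := exists_bound_multiPow_of_isCompact (hK.cthickening (r := r / 2 / 2)) hw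
      (half_lt_self hr0) N₀
    refine DbarBound.derivExpSmallOver hs hC₀ (half_pos hr0) (by linarith) hB
      (hb.mono_radius (half_le_self hr0.le)) (hw.mono (tube_subset_tube (half_le_self hr0.le))) hw0
      (M := M) fun α hα z hz hzr => ?_
    obtain ⟨x, hx, hzx⟩ := hz
    exact hM α hα z (Metric.mem_cthickening_of_dist_le _ x _ _ hx hzx) hzr.le
  · rintro ⟨M, r', hr', hM⟩
    set ρ := min r r' with hρ
    have hρ0 : 0 < ρ := lt_min hr0 hr'
    have hρr : ρ ≤ r := min_le_left _ _
    have hle : ρ / 2 ^ N₀ ≤ ρ := div_le_self hρ0.le (one_le_pow₀ (by norm_num))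
    obtain ⟨M', hM'⟩ := (hb.mono_radius hρr).exists_bound_multiPow ha hC₀ hρ0 hB
      (hw.mono (tube_subset_tube hρr))
      (fun z hz => hM z ((le_of_lt hz).trans (min_le_right _ _))) le_rfl
    exact DbarBound.derivExpSmallOver hs hC₀ (by positivity) (hle.trans (hρr.trans hr1)) hB
      (hb.mono_radius (hle.trans hρr)) (hw.mono (tube_subset_tube (hle.trans hρr))) hw0
      fun α hα z _ hz => hM' α hα z hz
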